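/- **Outer bound for product broadcast channels.** Let $\mathcal X_1,\mathcal Y_1,\mathcal Z_1,\mathcal X_2,\mathcal Y_2,\mathcal Z_2$ be finite sets, let $\mathfrak q_1(y_1,z_1|x_1)$ and $\mathfrak q_2(y_2,z_2|x_2)$ be discrete memoryless broadcast channels, and let $$\mathfrak q(y_1y_2,z_1z_2|x_1x_2)=\mathfrak q_1(y_1,z_1|x_1)\,\mathfrak q_2(y_2,z_2|x_2)$$ be their product, with receivers $Y=(Y_1,Y_2)$ and $Z=(Z_1,Z_2)$. A triple $(R_0,R_1,R_2)$ of nonnegative reals is *achievable* for $\mathfrak q$ if there is a sequence, over block lengths $n$, of codes, each consisting of an encoder mapping $(m_0,m_1,m_2)$ to an input sequence of length $n$, a decoder at $Y$ estimating $(m_0,m_1)$ from the first output sequence, and a decoder at $Z$ estimating $(m_0,m_2)$ from the second output sequence, such that, when $M_0,M_1,M_2$ are independent and $M_i$ is uniform on the integers in $[1,2^{nR_i}]$, the error probabilities of both receivers tend to $0$ as $n\to\infty$. The *capacity region* is the closure of the set of achievable triples. Then every triple $(R_0,R_1,R_2)$ of the capacity region of $\mathfrak q$ belongs to the union, over all pairs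 of probability distributions $p_1(w_1,v_1,u_1,x_1)$, $p_2(w_2,v_2,u_2,x_2)$ (the auxiliary variables $W_i,V_i,U_i$ having arbitrary finite alphabets), of the sets of triples satisfying the following five conditions, where $$C:=\min\{I(W_1;Y_1)+I(W_2;Y_2),\; I(W_1;Z_1)+I(W_2;Z_2)\}:$$ \begin{align*} R_0 &\le C,\\ R_0+R_1 &\le C+I(U_1;Y_1|W_1)+I(U_2;Y_2|W_2),\\ R_0+R_2 &\le C+I(V_1;Z_1|W_1)+I(V_2;Z_2|W_2),\\ R_0+R_1+R_2 &\le C+I(U_2;Y_2|W_2)+I(X_2;Z_2|U_2,W_2)\\ &\quad+\min\{I(U_1;Y_1|W_1)+I(X_1;Z_1|U_1,W_1),\; I(V_1;Z_1|W_1)+I(X_1;Y_1|V_1,W_1)\},\\ R_0+R_1+R_2 &\le C+\min\{I(U_2;Y_2|W_2)+I(X_2;Z_2|U_2,W_2),\; I(V_2;Z_2|W_2)+I(X_2;Y_2|V_2,W_2)\}\\ &\quad+I(V_1;Z_1|W_1)+I(X_1;Y_1|V_1,W_1). \end{align*} Here the joint law is $p_1(w_1,v_1,u_1,x_1)\,p_2(w_2,v_2,u_2,x_2)\,\mathfrak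 q_1(y_1,z_1|x_1)\,\mathfrak q_2(y_2,z_2|x_2)$, and (conditional) mutual informations are measured in bits. -/

import Mathlib

open Filter Topology

noncomputable section

/-! ### Entropy and mutual information of finite random variables, in bits -/

section Information

variable {Ω A B C : Type*} [Fintype Ω] [Fintype A] [Fintype B] [Fintype C]

open Classical in
/-- The law of the random variable `f`, when the point `ω` has probability `P ω`. -/
def lawOf (P : Ω → ℝ) (f : Ω → A) (a : A) : ℝ :=
  ∑ ω, if f ω = a then P ω else 0

/-- Shannon entropy `H(f) = - ∑ₐ P(f = a) log₂ P(f = a)`. -/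
def entropyOf (P : Ω → ℝ) (f : Ω → A) : ℝ :=
  (∑ a, Real.negMulLog (lawOf P f a)) / Real.log 2

/-- Mutual information `I(f; g) = H(f) + H(g) - H(f, g)`. -/
def mutInfo (P : Ω → ℝ) (f : Ω → A) (g : Ω → B) : ℝ :=
  entropyOf P f + entropyOf P g - entropyOf P (fun ω => (f ω, g ω))

/-- Conditional mutual information
`I(f; g | h) = H(f, h) + H(g, h) - H(f, g, h) - H(h)`. -/
def condMutInfo (P : Ω → ℝ) (f : Ω → A) (g : Ω → B) (h : Ω → C) : ℝ :=
  entropyOf P (fun ω => (f ω, h ω)) + entropyOf P (fun ω => (g ω, h ω))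
    - entropyOf P (fun ω => (f ω, g ω, h ω)) - entropyOf P h

end Information

/-! ### Discrete memoryless broadcast channels, codes, and the capacity region -/

/-- A broadcast channel `q(y, z | x)` with finite alphabets: `q x` is a probability
vector on `Y × Z` for every input letter `x`. -/
abbrev BroadcastChannel (X Y Z : Type*) [Fintype Y] [Fintype Z] :=
  X → stdSimplex ℝ (Y × Z)

/-- The product channel `q(y₁y₂, z₁z₂ | x₁x₂) = q₁(y₁, z₁ | x₁) q₂(y₂, z₂ | x₂)`. -/
def BroadcastChannel.prod {X₁ Y₁ Z₁ X₂ Y₂ Z₂ : Type*}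
    [Fintype Y₁] [Fintype Z₁] [Fintype Y₂] [Fintype Z₂]
    (q₁ : BroadcastChannel X₁ Y₁ Z₁) (q₂ : BroadcastChannel X₂ Y₂ Z₂) :
    BroadcastChannel (X₁ × X₂) (Y₁ × Y₂) (Z₁ × Z₂) := fun x =>
  ⟨fun o => (q₁ x.1).1 (o.1.1, o.2.1) * (q₂ x.2).1 (o.1.2, o.2.2), by
    refine ⟨fun o => mul_nonneg ((q₁ x.1).2.1 _) ((q₂ x.2).2.1 _), ?_⟩
    rw [← (Equiv.prodProdProdComm Y₁ Z₁ Y₂ Z₂).sum_comp]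
    simp only [Equiv.prodProdProdComm_apply]
    rw [Fintype.sum_prod_type, ← Finset.sum_mul_sum, (q₁ x.1).2.2, (q₂ x.2).2.2, one_mul]⟩

/-- A block code of length `n` with `K₀`, `K₁`, `K₂` values of the common message, of the
private message of receiver `Y` and of the private message of receiver `Z`. -/
structure BroadcastCode (X Y Z : Type*) (n K₀ K₁ K₂ : ℕ) where
  /-- the encoder -/
  enc : Fin K₀ → Fin K₁ → Fin K₂ → (Fin n → X)
  /-- the estimate of the common message and of the first private message at receiver `Y` -/
  decY : (Fin n → Y) → Fin K₀ × Fin K₁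
  /-- the estimate of the common message and of the second private message at receiver `Z` -/
  decZ : (Fin n → Z) → Fin K₀ × Fin K₂

namespace BroadcastCode

variable {X Y Z : Type*} [Fintype Y] [Fintype Z] {n K₀ K₁ K₂ : ℕ}

open Classical in
/-- The probability that receiver `Y` does not recover the common message and its private
message, for independent, uniformly distributed messages and memoryless use of the channel. -/
def errY (q : BroadcastChannel X Y Z) (c : BroadcastCode X Y Z n K₀ K₁ K₂) : ℝ :=
  (∑ m₀, ∑ m₁, ∑ m₂, ∑ y : Fin n → Y, ∑ z : Fin n → Z,
    if c.decY y ≠ (m₀, m₁) then ∏ i, (q (c.enc m₀ m₁ m₂ i)).1 (y i, z i) else 0)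
    / ((K₀ : ℝ) * K₁ * K₂)

open Classical in
/-- The probability that receiver `Z` does not recover the common message and its private
message, for independent, uniformly distributed messages and memoryless use of the channel. -/
def errZ (q : BroadcastChannel X Y Z) (c : BroadcastCode X Y Z n K₀ K₁ K₂) : ℝ :=
  (∑ m₀, ∑ m₁, ∑ m₂, ∑ y : Fin n → Y, ∑ z : Fin n → Z,
    if c.decZ z ≠ (m₀, m₂) then ∏ i, (q (c.enc m₀ m₁ m₂ i)).1 (y i, z i) else 0)
    / ((K₀ : ℝ) * K₁ * K₂)

end BroadcastCode

/-- The number of integers in `[1, 2 ^ (n R)]`. -/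
def numMessages (n : ℕ) (R : ℝ) : ℕ := ⌊(2 : ℝ) ^ ((n : ℝ) * R)⌋₊

/-- A triple `(R₀, R₁, R₂)` of nonnegative rates is achievable if some sequence of codes of
lengths `n = 0, 1, 2, …` with messages in `[1 : 2 ^ (n Rᵢ)]` has both error probabilities
tending to zero. -/
def IsAchievable {X Y Z : Type*} [Fintype Y] [Fintype Z] (q : BroadcastChannel X Y Z)
    (R : ℝ × ℝ × ℝ) : Prop :=
  0 ≤ R.1 ∧ 0 ≤ R.2.1 ∧ 0 ≤ R.2.2 ∧
  ∃ c : ∀ n : ℕ, BroadcastCode X Y Z n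
      (numMessages n R.1) (numMessages n R.2.1) (numMessages n R.2.2),
    Tendsto (fun n => (c n).errY q) atTop (𝓝 0) ∧
    Tendsto (fun n => (c n).errZ q) atTop (𝓝 0)

/-- The capacity region with a common message: the closure of the achievable triples. -/
def capacityRegion {X Y Z : Type*} [Fintype Y] [Fintype Z] (q : BroadcastChannel X Y Z) :
    Set (ℝ × ℝ × ℝ) :=
  closure {R | IsAchievable q R}

/-! ### The outer bound for product channels -/

/-- The joint law `p(w, v, u, x) q(y, z | x)` of `(W, V, U, X, Y, Z)`; in particular
`(W, V, U) → X → (Y, Z)` is a Markov chain. -/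
def jointLaw {W V U X Y Z : Type*} [Fintype Y] [Fintype Z]
    (p : W × V × U × X → ℝ) (q : BroadcastChannel X Y Z) :
    (W × V × U × X) × (Y × Z) → ℝ :=
  fun ω => p ω.1 * (q ω.1.2.2.2).1 ω.2

section Terms

variable {W V U X Y Z : Type*}
  [Fintype W] [Fintype V] [Fintype U] [Fintype X] [Fintype Y] [Fintype Z]
  (p : W × V × U × X → ℝ) (q : BroadcastChannel X Y Z)

/-- `I(W; Y)` -/
def infoWY : ℝ := mutInfo (jointLaw p q) (fun ω => ω.1.1) (fun ω => ω.2.1)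

/-- `I(W; Z)` -/
def infoWZ : ℝ := mutInfo (jointLaw p q) (fun ω => ω.1.1) (fun ω => ω.2.2)

/-- `I(U; Y | W)` -/
def infoUY : ℝ :=
  condMutInfo (jointLaw p q) (fun ω => ω.1.2.2.1) (fun ω => ω.2.1) (fun ω => ω.1.1)

/-- `I(V; Z | W)` -/
def infoVZ : ℝ :=
  condMutInfo (jointLaw p q) (fun ω => ω.1.2.1) (fun ω => ω.2.2) (fun ω => ω.1.1)

/-- `I(X; Z | U, W)` -/
def infoXZ : ℝ :=
  condMutInfo (jointLaw p q) (fun ω => ω.1.2.2.2) (fun ω => ω.2.2)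
    (fun ω => (ω.1.2.2.1, ω.1.1))

/-- `I(X; Y | V, W)` -/
def infoXY : ℝ :=
  condMutInfo (jointLaw p q) (fun ω => ω.1.2.2.2) (fun ω => ω.2.1)
    (fun ω => (ω.1.2.1, ω.1.1))

end Terms

/-- `min {I(W₁; Y₁) + I(W₂; Y₂), I(W₁; Z₁) + I(W₂; Z₂)}` -/
def commonTerm {W₁ V₁ U₁ X₁ Y₁ Z₁ W₂ V₂ U₂ X₂ Y₂ Z₂ : Type*}
    [Fintype W₁] [Fintype V₁] [Fintype U₁] [Fintype X₁] [Fintype Y₁] [Fintype Z₁]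
    [Fintype W₂] [Fintype V₂] [Fintype U₂] [Fintype X₂] [Fintype Y₂] [Fintype Z₂]
    (p₁ : W₁ × V₁ × U₁ × X₁ → ℝ) (q₁ : BroadcastChannel X₁ Y₁ Z₁)
    (p₂ : W₂ × V₂ × U₂ × X₂ → ℝ) (q₂ : BroadcastChannel X₂ Y₂ Z₂) : ℝ :=
  min (infoWY p₁ q₁ + infoWY p₂ q₂) (infoWZ p₁ q₁ + infoWZ p₂ q₂)

/-- The triples allowed by the five inequalities for the law
`p₁(w₁, v₁, u₁, x₁) p₂(w₂, v₂, u₂, x₂)`. -/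
def regionOf {W₁ V₁ U₁ X₁ Y₁ Z₁ W₂ V₂ U₂ X₂ Y₂ Z₂ : Type*}
    [Fintype W₁] [Fintype V₁] [Fintype U₁] [Fintype X₁] [Fintype Y₁] [Fintype Z₁]
    [Fintype W₂] [Fintype V₂] [Fintype U₂] [Fintype X₂] [Fintype Y₂] [Fintype Z₂]
    (p₁ : W₁ × V₁ × U₁ × X₁ → ℝ) (q₁ : BroadcastChannel X₁ Y₁ Z₁)
    (p₂ : W₂ × V₂ × U₂ × X₂ → ℝ) (q₂ : BroadcastChannel X₂ Y₂ Z₂) :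
    Set (ℝ × ℝ × ℝ) :=
  {R | R.1 ≤ commonTerm p₁ q₁ p₂ q₂ ∧
    R.1 + R.2.1 ≤ commonTerm p₁ q₁ p₂ q₂ + infoUY p₁ q₁ + infoUY p₂ q₂ ∧
    R.1 + R.2.2 ≤ commonTerm p₁ q₁ p₂ q₂ + infoVZ p₁ q₁ + infoVZ p₂ q₂ ∧
    R.1 + R.2.1 + R.2.2 ≤ commonTerm p₁ q₁ p₂ q₂
      + infoUY p₂ q₂ + infoXZ p₂ q₂
      + min (infoUY p₁ q₁ + infoXZ p₁ q₁) (infoVZ p₁ q₁ + infoXY p₁ q₁) ∧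
    R.1 + R.2.1 + R.2.2 ≤ commonTerm p₁ q₁ p₂ q₂
      + min (infoUY p₂ q₂ + infoXZ p₂ q₂) (infoVZ p₂ q₂ + infoXY p₂ q₂)
      + infoVZ p₁ q₁ + infoXY p₁ q₁}

/-- The union of the regions over all probability distributions `p₁`, `p₂`, where the
auxiliary variables `Wᵢ`, `Vᵢ`, `Uᵢ` take values in arbitrary finite sets. -/
def productOuterBound {X₁ Y₁ Z₁ X₂ Y₂ Z₂ : Type*}
    [Fintype X₁] [Fintype Y₁] [Fintype Z₁] [Fintype X₂] [Fintype Y₂] [Fintype Z₂]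
    (q₁ : BroadcastChannel X₁ Y₁ Z₁) (q₂ : BroadcastChannel X₂ Y₂ Z₂) :
    Set (ℝ × ℝ × ℝ) :=
  {R | ∃ a₁ b₁ c₁ a₂ b₂ c₂ : ℕ,
    ∃ p₁ ∈ stdSimplex ℝ (Fin a₁ × Fin b₁ × Fin c₁ × X₁),
    ∃ p₂ ∈ stdSimplex ℝ (Fin a₂ × Fin b₂ × Fin c₂ × X₂),
      R ∈ regionOf p₁ q₁ p₂ q₂}

end

/-! Fix a code with messages M₀, M₁, M₂. At time i the first component gets the auxiliary variable
W₁ = (M₀, Z₂ⁿ, Y₁ before i, Z₁ after i), the second W₂ = (M₀, Y₁ⁿ, Y₂ before i, Z₂ after i), and in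
both U = M₁, V = M₂. The crossed side information is the point. For s any group of messages
containing M₀, the Csiszár sum identity (`leftSum_sub_rightSum`) turns the difference of the sums of
H(Yᵢ | ·) and H(Zᵢ | ·) into H(s, Y₁, Z₂) - H(s, Z₁, Z₂) for the first component and H(s, Y₁, Y₂) -
H(s, Y₁, Z₂) for the second. On adding, the hybrid term cancels and the pair of channels behaves
like one channel. Submodularity bounds the added sums by H(Y | s) and H(Z | s), and Fano's
inequality finishes (`exists_isBoundedBy`). In the mixed sum-rate constraint, V on the first
component and U on the second, the hybrid term survives; submodularity in the messages given (Y₁,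
Z₂) removes it. The opposite mixture is not reached, whence the asymmetry of the last two
constraints.

The capacity region is a closure, while a union over all finite alphabets is not visibly closed. The
information terms, however, depend on the auxiliary variables only through the input law and the
conditional output entropies given W, (W, U) and (W, V). The possible values form the set
`entropySet`, a convex hull built over two inner hulls, one for U and one for V, and compact because
the dimension is finite. Convexity gives time sharing (`exists_average`), compactness gives a closed
outer bound (`isClosed_entropyOuterBound`), and Carathéodory's theorem, with U and V glued
conditionally independently given (W, X), returns to finite alphabets (`exists_of_mem_entropySet`).
Each term involves one component only, so the two laws can be treated separately. -/

/-! ### Shannon entropy of finite random variables -/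

section Entropy

variable {Ω A B C D : Type*} [Fintype Ω] {P : Ω → ℝ}

theorem lawOf_nonneg (hP : ∀ ω, 0 ≤ P ω) (f : Ω → A) (a : A) : 0 ≤ lawOf P f a :=
  Finset.sum_nonneg fun ω _ => by split_ifs <;> simp [hP]

theorem le_lawOf_apply (hP : ∀ ω, 0 ≤ P ω) (f : Ω → A) (ω : Ω) : P ω ≤ lawOf P f (f ω) := by
  classical
  have := Finset.single_le_sum (f := fun ω' => if f ω' = f ω then P ω' else 0)
    (fun ω' _ => by split_ifs <;> simp [hP]) (Finset.mem_univ ω)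
  simp only [if_true] at this
  unfold lawOf
  convert this

theorem sum_lawOf_mul [Fintype A] (P : Ω → ℝ) (f : Ω → A) (g : A → ℝ) :
    ∑ a, lawOf P f a * g a = ∑ ω, P ω * g (f ω) := by
  classical
  simp only [lawOf, Finset.sum_mul]
  rw [Finset.sum_comm]
  refine Finset.sum_congr rfl fun ω _ => ?_
  simp [ite_mul]

theorem sum_lawOf [Fintype A] (P : Ω → ℝ) (f : Ω → A) : ∑ a, lawOf P f a = ∑ ω, P ω := by
  simpa using sum_lawOf_mul P f fun _ => 1

theorem sum_lawOf_prodMk [Fintype B] (P : Ω → ℝ) (f : Ω → A) (g : Ω → B) (a : A) :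
    ∑ b, lawOf P (fun ω => (f ω, g ω)) (a, b) = lawOf P f a := by
  classical
  simp only [lawOf, Prod.mk.injEq]
  rw [Finset.sum_comm]
  refine Finset.sum_congr rfl fun ω _ => ?_
  by_cases h : f ω = a <;> simp [h]

theorem sum_lawOf_prodMk_left [Fintype A] (P : Ω → ℝ) (f : Ω → A) (g : Ω → B) (b : B) :
    ∑ a, lawOf P (fun ω => (f ω, g ω)) (a, b) = lawOf P g b := by
  classical
  simp only [lawOf, Prod.mk.injEq]
  rw [Finset.sum_comm]
  refine Finset.sum_congr rfl fun ω _ => ?_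
  by_cases h : g ω = b <;> simp [h]

/-- `lawOf` at a value only depends on the event that the value is taken. -/
theorem lawOf_congr {f : Ω → A} {g : Ω → B} {a : A} {b : B} (h : ∀ ω, f ω = a ↔ g ω = b) :
    lawOf P f a = lawOf P g b := by
  unfold lawOf
  refine Finset.sum_congr rfl fun ω _ => ?_
  by_cases hg : g ω = b
  · simp [hg, (h ω).2 hg]
  · have hf : f ω ≠ a := fun hf => hg ((h ω).1 hf)
    simp [hg, hf]

theorem lawOf_mono (hP : ∀ ω, 0 ≤ P ω) {f : Ω → A} {g : Ω → B} {a : A} {b : B}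
    (h : ∀ ω, f ω = a → g ω = b) : lawOf P f a ≤ lawOf P g b := by
  unfold lawOf
  refine Finset.sum_le_sum fun ω _ => ?_
  split_ifs with h1 h2 h2
  · exact le_rfl
  · exact absurd (h ω h1) h2
  · exact hP ω
  · exact le_rfl

/-- As an expectation over the sample space, entropy visibly depends only on the partition that `f`
generates. This makes all later regrouping of tuples a propositional matter. -/
theorem entropyOf_eq_sum [Fintype A] (P : Ω → ℝ) (f : Ω → A) :
    entropyOf P f = -(∑ ω, P ω * Real.log (lawOf P f (f ω))) / Real.log 2 := by
  unfold entropyOf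
  rw [← sum_lawOf_mul P f fun a => Real.log (lawOf P f a), ← Finset.sum_neg_distrib]
  simp only [Real.negMulLog, neg_mul]

theorem log_two_pos : 0 < Real.log 2 := Real.log_pos one_lt_two

/-- Variables that generate the same partition of the sample space have the same entropy. -/
theorem entropyOf_congr [Fintype A] [Fintype B] {f : Ω → A} {g : Ω → B}
    (h : ∀ ω ω', f ω = f ω' ↔ g ω = g ω') : entropyOf P f = entropyOf P g := by
  simp only [entropyOf_eq_sum]
  congr 2
  refine Finset.sum_congr rfl fun ω _ => ?_
  rw [lawOf_congr fun ω' => h ω' ω]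

theorem entropyOf_mono [Fintype A] [Fintype B] (hP : ∀ ω, 0 ≤ P ω) {f : Ω → A} {g : Ω → B}
    (h : ∀ ω ω', g ω = g ω' → f ω = f ω') : entropyOf P f ≤ entropyOf P g := by
  simp only [entropyOf_eq_sum]
  refine div_le_div_of_nonneg_right (neg_le_neg (Finset.sum_le_sum fun ω _ => ?_)) log_two_pos.le
  rcases (hP ω).eq_or_lt with h0 | h0
  · simp [← h0]
  · exact mul_le_mul_of_nonneg_left (Real.log_le_log (h0.trans_le (le_lawOf_apply hP g ω))
      (lawOf_mono hP fun ω' => h ω' ω)) h0.le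

/-- Gibbs' inequality. -/
theorem sum_mul_log_le [Fintype A] (hP : ∀ ω, 0 ≤ P ω) (f : Ω → A) (r : A → ℝ)
    (hr : ∀ a, 0 ≤ r a) (hr' : ∀ ω, 0 < P ω → 0 < r (f ω)) (hsum : ∑ a, r a ≤ ∑ ω, P ω) :
    ∑ ω, P ω * Real.log (r (f ω)) ≤ ∑ ω, P ω * Real.log (lawOf P f (f ω)) := by
  -- This is log t ≤ t - 1 at the ratio t of `r` to the true law, weighted by `P ω`.
  have key : ∀ ω, P ω * Real.log (r (f ω)) - P ω * Real.log (lawOf P f (f ω))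
      ≤ P ω * (r (f ω) / lawOf P f (f ω)) - P ω := by
    intro ω
    rcases (hP ω).eq_or_lt with h0 | h0
    · simp [← h0]
    · have h1 := h0.trans_le (le_lawOf_apply hP f ω)
      rw [← mul_sub, ← Real.log_div (hr' ω h0).ne' h1.ne']
      nlinarith [Real.log_le_sub_one_of_pos (div_pos (hr' ω h0) h1)]
  have h2 : ∑ ω, P ω * (r (f ω) / lawOf P f (f ω)) ≤ ∑ a, r a := by
    rw [← sum_lawOf_mul P f fun a => r a / lawOf P f a]
    refine Finset.sum_le_sum fun a _ => ?_
    rcases (lawOf_nonneg hP f a).eq_or_lt with h0 | h0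
    · simpa [← h0] using hr a
    · rw [mul_div_cancel₀ _ h0.ne']
  have h3 := Finset.sum_le_sum fun ω (_ : ω ∈ Finset.univ) => key ω
  rw [Finset.sum_sub_distrib, Finset.sum_sub_distrib] at h3
  linarith

/-- Gibbs' inequality against the law p(f, h) p(g, h) / p(h), under which `f` and `g` are
conditionally independent given `h`. -/
theorem entropyOf_prodMk_submodular [Fintype A] [Fintype B] [Fintype C] (hP : ∀ ω, 0 ≤ P ω)
    (f : Ω → A) (g : Ω → B) (h : Ω → C) :
    entropyOf P (fun ω => (f ω, g ω, h ω)) + entropyOf P h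
      ≤ entropyOf P (fun ω => (f ω, h ω)) + entropyOf P (fun ω => (g ω, h ω)) := by
  have key := sum_mul_log_le hP (fun ω => (f ω, g ω, h ω))
    (fun t => lawOf P (fun ω => (f ω, h ω)) (t.1, t.2.2)
      * lawOf P (fun ω => (g ω, h ω)) (t.2.1, t.2.2) / lawOf P h t.2.2)
    (fun t => div_nonneg (mul_nonneg (lawOf_nonneg hP _ _) (lawOf_nonneg hP _ _))
      (lawOf_nonneg hP _ _))
    (fun ω h0 => div_pos (mul_pos (h0.trans_le (le_lawOf_apply hP (fun ω => (f ω, h ω)) ω))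
      (h0.trans_le (le_lawOf_apply hP (fun ω => (g ω, h ω)) ω)))
      (h0.trans_le (le_lawOf_apply hP h ω)))
    (by
      rw [← sum_lawOf P h]
      simp only [Fintype.sum_prod_type]
      rw [show (∑ x, ∑ x_1, ∑ x_2, lawOf P (fun ω => (f ω, h ω)) (x, x_2)
          * lawOf P (fun ω => (g ω, h ω)) (x_1, x_2) / lawOf P h x_2)
        = ∑ c, (∑ a, lawOf P (fun ω => (f ω, h ω)) (a, c))
          * (∑ b, lawOf P (fun ω => (g ω, h ω)) (b, c)) / lawOf P h c from ?_]
      · refine Finset.sum_le_sum fun c _ => ?_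
        rw [sum_lawOf_prodMk_left, sum_lawOf_prodMk_left]
        exact (mul_self_div_self _).le
      · simp only [Finset.sum_mul_sum, Finset.sum_div]
        rw [Finset.sum_comm]
        conv_lhs => rw [Finset.sum_comm]
        conv_lhs => enter [2, x]; rw [Finset.sum_comm]
        rw [Finset.sum_comm])
  have e : ∑ ω, P ω * Real.log (lawOf P (fun ω => (f ω, h ω)) (f ω, h ω)
      * lawOf P (fun ω => (g ω, h ω)) (g ω, h ω) / lawOf P h (h ω))
      = ∑ ω, P ω * Real.log (lawOf P (fun ω => (f ω, h ω)) (f ω, h ω))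
      + ∑ ω, P ω * Real.log (lawOf P (fun ω => (g ω, h ω)) (g ω, h ω))
      - ∑ ω, P ω * Real.log (lawOf P h (h ω)) := by
    rw [← Finset.sum_add_distrib, ← Finset.sum_sub_distrib]
    refine Finset.sum_congr rfl fun ω _ => ?_
    rcases (hP ω).eq_or_lt with h0 | h0
    · simp [← h0]
    · have h1 := h0.trans_le (le_lawOf_apply hP (fun ω => (f ω, h ω)) ω)
      have h2 := h0.trans_le (le_lawOf_apply hP (fun ω => (g ω, h ω)) ω)
      have h3 := h0.trans_le (le_lawOf_apply hP h ω)
      rw [Real.log_div (mul_pos h1 h2).ne' h3.ne', Real.log_mul h1.ne' h2.ne']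
      ring
  rw [e] at key
  simp only [entropyOf_eq_sum]
  rw [← add_div, ← add_div]
  exact div_le_div_of_nonneg_right (by linarith) log_two_pos.le

/-- Submodularity of entropy, in terms of the partitions generated by the variables. -/
theorem entropyOf_submodular [Fintype A] [Fintype B] [Fintype C] [Fintype D]
    (hP : ∀ ω, 0 ≤ P ω) (f : Ω → A) (g : Ω → B) (j : Ω → C) (m : Ω → D)
    (hj : ∀ ω ω', j ω = j ω' ↔ f ω = f ω' ∧ g ω = g ω')
    (hf : ∀ ω ω', f ω = f ω' → m ω = m ω') (hg : ∀ ω ω', g ω = g ω' → m ω = m ω') :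
    entropyOf P j + entropyOf P m ≤ entropyOf P f + entropyOf P g := by
  have key := entropyOf_prodMk_submodular hP f g m
  rwa [entropyOf_congr (f := fun ω => (f ω, g ω, m ω)) (g := j),
    entropyOf_congr (f := fun ω => (f ω, m ω)) (g := f),
    entropyOf_congr (f := fun ω => (g ω, m ω)) (g := g)] at key
  · intro ω ω'; simpa using hg ω ω'
  · intro ω ω'; simpa using hf ω ω'
  · intro ω ω'
    rw [hj]
    simp only [Prod.mk.injEq]
    exact ⟨fun h => ⟨h.1, h.2.1⟩, fun h => ⟨h.1, h.2, hf _ _ h.1⟩⟩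

theorem entropyOf_const [Fintype A] (hP1 : ∑ ω, P ω = 1) (a : A) :
    entropyOf P (fun _ => a) = 0 := by
  rw [entropyOf_eq_sum]
  simp [lawOf, hP1]

theorem entropyOf_prodMk_le [Fintype A] [Fintype B] (hP : ∀ ω, 0 ≤ P ω) (hP1 : ∑ ω, P ω = 1)
    (f : Ω → A) (g : Ω → B) :
    entropyOf P (fun ω => (f ω, g ω)) ≤ entropyOf P f + entropyOf P g := by
  have := entropyOf_submodular hP f g (fun ω => (f ω, g ω)) (fun _ => ()) (by simp) (by simp)
    (by simp)
  rwa [entropyOf_const hP1, add_zero] at this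

theorem entropyOf_uniform [Fintype A] (f : Ω → A) (hf : ∀ a, lawOf P f a = 1 / Fintype.card A)
    (hA : 0 < Fintype.card A) : entropyOf P f = Real.logb 2 (Fintype.card A) := by
  unfold entropyOf Real.logb
  have h : (Fintype.card A : ℝ) ≠ 0 := by positivity
  simp only [hf, Finset.sum_const, Finset.card_univ, nsmul_eq_mul, Real.negMulLog, one_div,
    Real.log_inv]
  field_simp

open Classical in
/-- Fano's inequality. -/
theorem fano [Fintype A] [Fintype B] (hP : ∀ ω, 0 ≤ P ω) (hP1 : ∑ ω, P ω = 1)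
    (f : Ω → A) (g : Ω → B) (d : B → A) :
    entropyOf P (fun ω => (f ω, g ω)) - entropyOf P g
      ≤ 1 + (∑ ω, if d (g ω) ≠ f ω then P ω else 0) * Real.logb 2 (Fintype.card A) := by
  have hne : Nonempty Ω := by
    by_contra h
    rw [not_nonempty_iff] at h
    simp at hP1
  have : Nonempty A := hne.map f
  have hK : (0 : ℝ) < Fintype.card A := by exact_mod_cast Fintype.card_pos
  set K : ℝ := (Fintype.card A : ℝ) with hKdef
  -- The comparison kernel puts half its mass on the decoded value and spreads the other half
  -- uniformly over all of `A`. Its logarithm costs one bit always and log K more on an error, so no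
  -- binary entropy function is needed. The overlap at `d b` only lowers the total mass below one.
  let r : A → B → ℝ := fun a b => if d b = a then 1 / 2 else 1 / (2 * K)
  have hr : ∀ a b, 0 < r a b := by
    intro a b; simp only [r]; split_ifs <;> positivity
  have hrsum : ∀ b, ∑ a, r a b ≤ 1 := by
    intro b
    have : ∀ a, r a b ≤ (if d b = a then 1 / 2 else 0) + 1 / (2 * K) := by
      intro a
      simp only [r]; split_ifs
      · have : 0 < 1 / (2 * K) := by positivity
        linarith
      · simp
    refine (Finset.sum_le_sum fun a _ => this a).trans ?_
    rw [Finset.sum_add_distrib]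
    simp only [Finset.sum_ite_eq, Finset.mem_univ, if_true, Finset.sum_const, Finset.card_univ,
      nsmul_eq_mul, ← hKdef]
    field_simp
    norm_num
  have key := sum_mul_log_le hP (fun ω => (f ω, g ω)) (fun t => lawOf P g t.2 * r t.1 t.2)
    (fun t => mul_nonneg (lawOf_nonneg hP _ _) (hr _ _).le)
    (fun ω h0 => mul_pos (h0.trans_le (le_lawOf_apply hP g ω)) (hr _ _))
    (by
      rw [← sum_lawOf P g, Fintype.sum_prod_type_right]
      refine Finset.sum_le_sum fun b _ => ?_
      simp only [← Finset.mul_sum]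
      exact mul_le_of_le_one_right (lawOf_nonneg hP _ _) (hrsum b))
  have e : ∀ ω, P ω * Real.log (lawOf P g (g ω) * r (f ω) (g ω))
      = P ω * Real.log (lawOf P g (g ω)) - P ω * Real.log 2
        - (if d (g ω) ≠ f ω then P ω else 0) * Real.log K := by
    intro ω
    rcases (hP ω).eq_or_lt with h0 | h0
    · simp [← h0]
    · rw [Real.log_mul (h0.trans_le (le_lawOf_apply hP g ω)).ne' (hr _ _).ne']
      by_cases h : d (g ω) = f ω
      · simp only [r, h, if_true, ne_eq, not_true_eq_false, if_false, one_div, Real.log_inv]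
        ring
      · simp only [r, h, if_false, ne_eq, not_false_eq_true, if_true, one_div, Real.log_inv,
          Real.log_mul two_ne_zero hK.ne']
        ring
  simp only [e, Finset.sum_sub_distrib, ← Finset.sum_mul, hP1, one_mul] at key
  simp only [entropyOf_eq_sum]
  rw [← sub_div, div_le_iff₀ log_two_pos, add_mul, one_mul, mul_assoc, Real.logb,
    div_mul_cancel₀ _ log_two_pos.ne']
  linarith

end Entropy

/-! ### Entropy of the output of a channel -/

section OutputEntropy

variable {X Y : Type*} [Fintype X] [Fintype Y]

/-- For a kernel `k` and a finite measure `m` on the inputs, the total mass of `m` times the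
entropy (in bits) of the output for the normalized input law. -/
noncomputable def outputEntropy (k : X → Y → ℝ) (m : X → ℝ) : ℝ :=
  (∑ y, Real.negMulLog (∑ x, m x * k x y) - Real.negMulLog (∑ x, m x)) / Real.log 2

/-- The conditional entropy of the output given the input, for the input law `m`. -/
noncomputable def noiseEntropy (k : X → Y → ℝ) (m : X → ℝ) : ℝ :=
  (∑ x, m x * ∑ y, Real.negMulLog (k x y)) / Real.log 2

/-- The output has the same total mass as `m`, so subtracting the mass term cancels the contribution
of log c. Homogeneity lets unnormalized measures m_w = P(W = w, X = ·) stand for conditional laws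
weighted by P(W = w). -/
theorem outputEntropy_smul {k : X → Y → ℝ} (hk : ∀ x, ∑ y, k x y = 1) (c : ℝ) (m : X → ℝ) :
    outputEntropy k (c • m) = c * outputEntropy k m := by
  have h1 : ∀ y, ∑ x, (c • m) x * k x y = c * ∑ x, m x * k x y := by
    intro y; simp [Finset.mul_sum, mul_assoc]
  have h2 : ∑ x, (c • m) x = c * ∑ x, m x := by simp [Finset.mul_sum]
  have h3 : ∑ y, ∑ x, m x * k x y = ∑ x, m x := by
    rw [Finset.sum_comm]
    simp [← Finset.mul_sum, hk]
  simp only [outputEntropy, h1, h2, Real.negMulLog_mul, Finset.sum_add_distrib, ← Finset.sum_mul,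
    ← Finset.mul_sum, h3]
  ring

@[simp] theorem outputEntropy_zero (k : X → Y → ℝ) : outputEntropy k 0 = 0 := by
  simp [outputEntropy]

theorem continuous_outputEntropy (k : X → Y → ℝ) : Continuous (outputEntropy k) := by
  unfold outputEntropy
  refine Continuous.div_const (Continuous.sub (continuous_finsetSum _ fun y _ =>
    Real.continuous_negMulLog.comp (by fun_prop)) (Real.continuous_negMulLog.comp (by fun_prop))) _

theorem continuous_noiseEntropy (k : X → Y → ℝ) : Continuous (noiseEntropy k) := by
  unfold noiseEntropy
  fun_prop

theorem outputEntropy_of_mem_stdSimplex (k : X → Y → ℝ) {m : X → ℝ} (hm : m ∈ stdSimplex ℝ X) :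
    outputEntropy k m = (∑ y, Real.negMulLog (∑ x, m x * k x y)) / Real.log 2 := by
  simp [outputEntropy, hm.2]

/-- On probability vectors the mass term vanishes, the output law is linear in the input law, and
`Real.negMulLog` is concave. -/
theorem concaveOn_outputEntropy {k : X → Y → ℝ} (hk : ∀ x y, 0 ≤ k x y) :
    ConcaveOn ℝ (stdSimplex ℝ X) (outputEntropy k) := by
  refine ⟨convex_stdSimplex ℝ X, fun p hp q hq a b ha hb hab => ?_⟩
  rw [outputEntropy_of_mem_stdSimplex k hp, outputEntropy_of_mem_stdSimplex k hq,
    outputEntropy_of_mem_stdSimplex k (convex_stdSimplex ℝ X hp hq ha hb hab)]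
  simp only [smul_eq_mul, ← mul_div_assoc, ← add_div]
  refine div_le_div_of_nonneg_right ?_ log_two_pos.le
  simp only [Finset.mul_sum, ← Finset.sum_add_distrib]
  refine Finset.sum_le_sum fun y _ => ?_
  have h := Real.concaveOn_negMulLog.2
    (x := ∑ x, p x * k x y) (Set.mem_Ici.2 (Finset.sum_nonneg fun x _ => mul_nonneg (hp.1 x) (hk x y)))
    (y := ∑ x, q x * k x y) (Set.mem_Ici.2 (Finset.sum_nonneg fun x _ => mul_nonneg (hq.1 x) (hk x y)))
    ha hb hab
  refine h.trans_eq ?_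
  congr 1
  simp only [smul_eq_mul, Finset.mul_sum, ← Finset.sum_add_distrib, Pi.add_apply, Pi.smul_apply]
  exact Finset.sum_congr rfl fun x _ => by ring

theorem noiseEntropy_sum {ι : Type*} (s : Finset ι) (k : X → Y → ℝ) (c : ℝ) (m : ι → X → ℝ) :
    noiseEntropy k (c • ∑ i ∈ s, m i) = c * ∑ i ∈ s, noiseEntropy k (m i) := by
  simp only [noiseEntropy, ← Finset.sum_div, ← mul_div_assoc]
  congr 1
  rw [Finset.sum_comm, Finset.mul_sum]
  refine Finset.sum_congr rfl fun x _ => ?_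
  simp [Finset.sum_mul, mul_assoc]

end OutputEntropy

section IsOutput

variable {Ω S X Y O R : Type*} [Fintype Ω] {P : Ω → ℝ}

/-- `f → g → h` is a Markov chain and `h` is the output of the kernel `k` for the input `g`. -/
def IsOutput (P : Ω → ℝ) (f : Ω → S) (g : Ω → X) (h : Ω → Y) (k : X → Y → ℝ) : Prop :=
  ∀ s x y, lawOf P (fun ω => (f ω, g ω, h ω)) (s, x, y)
    = lawOf P (fun ω => (f ω, g ω)) (s, x) * k x y

/-- Coarsening the past keeps the Markov property: sum the defining identity over the fibre of `φ`.
-/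
theorem IsOutput.map [Fintype S] {T : Type*} {f : Ω → S} {g : Ω → X} {h : Ω → Y} {k : X → Y → ℝ}
    (H : IsOutput P f g h k) (φ : S → T) : IsOutput P (fun ω => φ (f ω)) g h k := by
  intro t x y
  rw [← sum_lawOf_prodMk_left P f (fun ω => (φ (f ω), g ω, h ω)),
    ← sum_lawOf_prodMk_left P f (fun ω => (φ (f ω), g ω)), Finset.sum_mul]
  refine Finset.sum_congr rfl fun s _ => ?_
  by_cases hs : φ s = t
  · rw [lawOf_congr (g := fun ω => (f ω, g ω, h ω)) (b := (s, x, y)), H s x y]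
    · congr 1
      refine lawOf_congr fun ω => ?_
      simp only [Prod.mk.injEq]
      exact ⟨fun h => ⟨h.1, by rw [h.1, hs], h.2⟩, fun h => ⟨h.1, h.2.2⟩⟩
    · intro ω
      simp only [Prod.mk.injEq]
      exact ⟨fun h => ⟨h.1, h.2.2⟩, fun h => ⟨h.1, by rw [h.1, hs], h.2⟩⟩
  · have h0 : ∀ {B : Type _} (j : Ω → B) (b : B),
        lawOf P (fun ω => (f ω, φ (f ω), j ω)) (s, t, b) = 0 := by
      intro B j b
      refine Finset.sum_eq_zero fun ω _ => if_neg ?_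
      simp only [Prod.mk.injEq, not_and]
      rintro rfl h
      exact absurd h hs
    refine (Finset.sum_eq_zero fun ω _ => if_neg ?_).trans
      (zero_mul (k x y) ▸ congrArg (· * k x y) (h0 g x).symm)
    simp only [Prod.mk.injEq, not_and]
    rintro rfl h
    exact absurd h hs

theorem IsOutput.law_eq [Fintype X] {f : Ω → S} {g : Ω → X} {h : Ω → Y} {k : X → Y → ℝ}
    (H : IsOutput P f g h k) (s : S) (y : Y) :
    lawOf P (fun ω => (f ω, h ω)) (s, y) = ∑ x, lawOf P (fun ω => (f ω, g ω)) (s, x) * k x y := by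
  simp only [← H s _ y]
  rw [← sum_lawOf_prodMk P (fun ω => (f ω, h ω)) g]
  refine Finset.sum_congr rfl fun x _ => lawOf_congr fun ω => ?_
  simp only [Prod.mk.injEq]
  tauto

/-- The bridge from random variables to measures: H(h | f) becomes a sum of homogeneous output
entropies, one for each value of `f`. -/
theorem IsOutput.entropyOf_sub [Fintype S] [Fintype X] [Fintype Y] {f : Ω → S} {g : Ω → X}
    {h : Ω → Y} {k : X → Y → ℝ} (H : IsOutput P f g h k) :
    entropyOf P (fun ω => (f ω, h ω)) - entropyOf P f
      = ∑ s, outputEntropy k fun x => lawOf P (fun ω => (f ω, g ω)) (s, x) := by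
  unfold entropyOf outputEntropy
  rw [← sub_div, ← Finset.sum_div, Finset.sum_sub_distrib, Fintype.sum_prod_type]
  simp only [H.law_eq, sum_lawOf_prodMk]

theorem IsOutput.entropyOf_eq [Fintype X] [Fintype Y] (hP1 : ∑ ω, P ω = 1) {g : Ω → X}
    {h : Ω → Y} {k : X → Y → ℝ} (H : IsOutput P (fun _ => ()) g h k) :
    entropyOf P h = outputEntropy k (lawOf P g) := by
  have := H.entropyOf_sub
  rw [entropyOf_const hP1, sub_zero, entropyOf_congr (g := h) (by simp)] at this
  rw [this]
  simp only [Finset.univ_unique, Finset.sum_singleton]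
  congr 1
  funext x
  exact lawOf_congr (by simp)

/-- The entropy of the output, given data that determine the input. -/
theorem IsOutput.entropyOf_sub_of_determines [Fintype S] [Fintype X] [Fintype Y] {f : Ω → S}
    {g : Ω → X} {h : Ω → Y} {k : X → Y → ℝ} (H : IsOutput P f g h k) (hk : ∀ x, ∑ y, k x y = 1)
    (φ : S → X) (hφ : ∀ ω, g ω = φ (f ω)) :
    entropyOf P (fun ω => (f ω, h ω)) - entropyOf P f = noiseEntropy k (lawOf P g) := by
  classical
  -- The joint law of data and input lives on the graph of `φ`, so given the data only the channel
  -- noise is random.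
  have h0 : ∀ s x, lawOf P (fun ω => (f ω, g ω)) (s, x)
      = if x = φ s then lawOf P f s else 0 := by
    intro s x
    split_ifs with hx
    · refine lawOf_congr fun ω => ?_
      simp only [Prod.mk.injEq, hφ, hx]
      exact ⟨fun h => h.1, fun h => ⟨h, by rw [h]⟩⟩
    · unfold lawOf
      refine Finset.sum_eq_zero fun ω _ => if_neg ?_
      simp only [Prod.mk.injEq, hφ, not_and]
      rintro rfl h
      exact hx h.symm
  have h1 : ∀ s y, lawOf P (fun ω => (f ω, h ω)) (s, y) = lawOf P f s * k (φ s) y := by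
    intro s y
    rw [H.law_eq]
    simp [h0]
  have h2 : ∀ x, lawOf P g x = ∑ s, if x = φ s then lawOf P f s else 0 := by
    intro x
    rw [← sum_lawOf_prodMk_left P f g x]
    simp only [h0]
  unfold entropyOf noiseEntropy
  rw [← sub_div, Fintype.sum_prod_type, ← Finset.sum_sub_distrib]
  congr 1
  simp only [h1, h2, Real.negMulLog_mul, Finset.sum_add_distrib, ← Finset.sum_mul, hk, one_mul,
    ← Finset.mul_sum, add_sub_cancel_left]
  simp only [Finset.sum_mul]
  rw [Finset.sum_comm]
  simp

/-- A sample point splits into data `r` and fresh noise `o` drawn from `κ (ξ r)`; `f` does not see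
the noise. -/
theorem isOutput_of_equiv [Fintype O] [Fintype R] (e : Ω ≃ R × O) (Q : R → ℝ) (ξ : R → X)
    (κ : X → O → ℝ) (hκ : ∀ x, ∑ o, κ x o = 1) (η : O → Y) {f : Ω → S} {g : Ω → X} {h : Ω → Y}
    (hP : ∀ r o, P (e.symm (r, o)) = Q r * κ (ξ r) o)
    (hf : ∀ r o o', f (e.symm (r, o)) = f (e.symm (r, o')))
    (hg : ∀ r o, g (e.symm (r, o)) = ξ r) (hh : ∀ r o, h (e.symm (r, o)) = η o) :
    IsOutput P f g h fun x => lawOf (κ x) η := by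
  classical
  intro s x y
  unfold lawOf
  rw [← e.symm.sum_comp, ← e.symm.sum_comp, Fintype.sum_prod_type, Fintype.sum_prod_type,
    Finset.sum_mul]
  refine Finset.sum_congr rfl fun r _ => ?_
  have hO : Nonempty O := by
    by_contra hO
    rw [not_nonempty_iff] at hO
    simpa using hκ (ξ r)
  obtain ⟨o₀⟩ := hO
  simp only [Prod.mk.injEq, hP, hg, hh, hf r _ o₀]
  by_cases h1 : f (e.symm (r, o₀)) = s
  · by_cases h2 : ξ r = x
    · simp only [h1, h2, true_and, and_self, if_true, ← Finset.mul_sum, hκ, mul_one]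
      rw [Finset.mul_sum]
      exact Finset.sum_congr rfl fun o _ => by split_ifs <;> simp
    · simp [h2]
  · simp [h1]

end IsOutput

/-! ### The Csiszár sum identity -/

section Csiszar

variable {Ω S A B : Type*} {P : Ω → ℝ} {n : ℕ}

/-- The variable `s` together with the coordinates of `f` before `i` and the coordinates of `g`
from `j` on. -/
def pastFuture (s : Ω → S) (f : Fin n → Ω → A) (g : Fin n → Ω → B) (i j : ℕ) (ω : Ω) :
    S × ({l : Fin n // l.1 < i} → A) × ({l : Fin n // j ≤ l.1} → B) :=
  (s ω, fun l => f l.1 ω, fun l => g l.1 ω)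

theorem pastFuture_eq_iff (s : Ω → S) (f : Fin n → Ω → A) (g : Fin n → Ω → B) (i j : ℕ)
    (ω ω' : Ω) : pastFuture s f g i j ω = pastFuture s f g i j ω' ↔
      s ω = s ω' ∧ (∀ l : Fin n, l.1 < i → f l ω = f l ω') ∧
        ∀ l : Fin n, j ≤ l.1 → g l ω = g l ω' := by
  simp [pastFuture, funext_iff]

variable [Fintype Ω] [Fintype S] [Fintype A] [Fintype B]

/-- The conditional entropies `H(f i | s, f₀, …, f (i - 1), g (i + 1), …)`. -/
theorem entropyOf_pastFuture_left (s : Ω → S) (f : Fin n → Ω → A) (g : Fin n → Ω → B)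
    (i : Fin n) (j : ℕ) : entropyOf P (fun ω => (pastFuture s f g i j ω, f i ω))
      = entropyOf P (pastFuture s f g (i + 1) j) := by
  refine entropyOf_congr fun ω ω' => ?_
  simp only [Prod.mk.injEq, pastFuture_eq_iff, Nat.lt_succ_iff_lt_or_eq]
  constructor
  · rintro ⟨⟨h1, h2, h3⟩, h4⟩
    refine ⟨h1, fun l hl => hl.elim (h2 l) fun h => ?_, h3⟩
    rwa [Fin.ext h]
  · rintro ⟨h1, h2, h3⟩
    exact ⟨⟨h1, fun l hl => h2 l (Or.inl hl), h3⟩, h2 i (Or.inr rfl)⟩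

theorem entropyOf_pastFuture_right (s : Ω → S) (f : Fin n → Ω → A) (g : Fin n → Ω → B)
    (i : Fin n) (j : ℕ) : entropyOf P (fun ω => (pastFuture s f g j (i + 1) ω, g i ω))
      = entropyOf P (pastFuture s f g j i) := by
  refine entropyOf_congr fun ω ω' => ?_
  simp only [Prod.mk.injEq, pastFuture_eq_iff]
  constructor
  · rintro ⟨⟨h1, h2, h3⟩, h4⟩
    refine ⟨h1, h2, fun l hl => hl.lt_or_eq.elim (fun h => h3 l h) fun h => ?_⟩
    rwa [← Fin.ext h]
  · rintro ⟨h1, h2, h3⟩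
    exact ⟨⟨h1, h2, fun l hl => h3 l (by omega)⟩, h3 i le_rfl⟩

theorem entropyOf_pastFuture_all_left (s : Ω → S) (f : Fin n → Ω → A) (g : Fin n → Ω → B) :
    entropyOf P (pastFuture s f g n n) = entropyOf P (fun ω => (s ω, fun i => f i ω)) := by
  refine entropyOf_congr fun ω ω' => ?_
  simp only [Prod.mk.injEq, pastFuture_eq_iff, funext_iff]
  exact ⟨fun h => ⟨h.1, fun l => h.2.1 l l.2⟩,
    fun h => ⟨h.1, fun l _ => h.2 l, fun l hl => absurd l.2 (by omega)⟩⟩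

theorem entropyOf_pastFuture_all_right (s : Ω → S) (f : Fin n → Ω → A) (g : Fin n → Ω → B) :
    entropyOf P (pastFuture s f g 0 0) = entropyOf P (fun ω => (s ω, fun i => g i ω)) := by
  refine entropyOf_congr fun ω ω' => ?_
  simp only [Prod.mk.injEq, pastFuture_eq_iff, funext_iff]
  exact ⟨fun h => ⟨h.1, fun l => h.2.2 l (Nat.zero_le _)⟩,
    fun h => ⟨h.1, fun l hl => absurd hl (by omega), fun l _ => h.2 l⟩⟩

theorem entropyOf_pastFuture_none (s : Ω → S) (f : Fin n → Ω → A) (g : Fin n → Ω → B) :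
    entropyOf P (pastFuture s f g 0 n) = entropyOf P s := by
  refine entropyOf_congr fun ω ω' => ?_
  simp only [pastFuture_eq_iff]
  exact ⟨fun h => h.1,
    fun h => ⟨h, fun l hl => absurd hl (by omega), fun l hl => absurd l.2 (by omega)⟩⟩

/-- The sum of the conditional entropies `H(f i | s, f₀, …, f (i - 1), g (i + 1), …)`. -/
noncomputable def leftSum (P : Ω → ℝ) (s : Ω → S) (f : Fin n → Ω → A) (g : Fin n → Ω → B) : ℝ :=
  ∑ i : Fin n, (entropyOf P (fun ω => (pastFuture s f g i (i + 1) ω, f i ω))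
    - entropyOf P (pastFuture s f g i (i + 1)))

/-- The sum of the conditional entropies `H(g i | s, f₀, …, f (i - 1), g (i + 1), …)`. -/
noncomputable def rightSum (P : Ω → ℝ) (s : Ω → S) (f : Fin n → Ω → A) (g : Fin n → Ω → B) : ℝ :=
  ∑ i : Fin n, (entropyOf P (fun ω => (pastFuture s f g i (i + 1) ω, g i ω))
    - entropyOf P (pastFuture s f g i (i + 1)))

/-- The Csiszár sum identity. -/
theorem leftSum_sub_rightSum (s : Ω → S) (f : Fin n → Ω → A) (g : Fin n → Ω → B) :
    leftSum P s f g - rightSum P s f g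
      = entropyOf P (fun ω => (s ω, fun i => f i ω)) - entropyOf P (fun ω => (s ω, fun i => g i ω)) := by
  unfold leftSum rightSum
  rw [← Finset.sum_sub_distrib, ← entropyOf_pastFuture_all_left s f g,
    ← entropyOf_pastFuture_all_right s f g]
  -- Adjoining `f i` moves both cut points to i + 1, adjoining `g i` moves both to i, and the
  -- conditioning terms cancel. What remains telescopes along the diagonal.
  simp only [entropyOf_pastFuture_left, entropyOf_pastFuture_right, sub_sub_sub_cancel_right]
  rw [Fin.sum_univ_eq_sum_range (fun i => entropyOf P (pastFuture s f g (i + 1) (i + 1))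
    - entropyOf P (pastFuture s f g i i)) n,
    Finset.sum_range_sub (fun i => entropyOf P (pastFuture s f g i i))]

/-- Dropping the future of `g` from the conditioning can only raise each term, by submodularity; the
chain rule then telescopes. -/
theorem leftSum_le (hP : ∀ ω, 0 ≤ P ω) (s : Ω → S) (f : Fin n → Ω → A) (g : Fin n → Ω → B) :
    leftSum P s f g ≤ entropyOf P (fun ω => (s ω, fun i => f i ω)) - entropyOf P s := by
  have h : ∀ i : Fin n, entropyOf P (fun ω => (pastFuture s f g i (i + 1) ω, f i ω))
      - entropyOf P (pastFuture s f g i (i + 1))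
      ≤ entropyOf P (pastFuture s f g (i + 1) n) - entropyOf P (pastFuture s f g i n) := by
    intro i
    rw [entropyOf_pastFuture_left]
    have := entropyOf_submodular hP (pastFuture s f g (i + 1) n) (pastFuture s f g i (i + 1))
      (pastFuture s f g (i + 1) (i + 1)) (pastFuture s f g i n)
      (by
        intro ω ω'
        simp only [pastFuture_eq_iff]
        exact ⟨fun h => ⟨⟨h.1, h.2.1, fun l hl => absurd l.2 (by omega)⟩,
          h.1, fun l hl => h.2.1 l (by omega), h.2.2⟩, fun h => ⟨h.1.1, h.1.2.1, h.2.2.2⟩⟩)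
      (by
        intro ω ω'
        simp only [pastFuture_eq_iff]
        exact fun h => ⟨h.1, fun l hl => h.2.1 l (by omega), h.2.2⟩)
      (by
        intro ω ω'
        simp only [pastFuture_eq_iff]
        exact fun h => ⟨h.1, h.2.1, fun l hl => absurd l.2 (by omega)⟩)
    linarith
  refine (Finset.sum_le_sum fun i _ => h i).trans_eq ?_
  rw [Fin.sum_univ_eq_sum_range (fun i => entropyOf P (pastFuture s f g (i + 1) n)
    - entropyOf P (pastFuture s f g i n)) n,
    Finset.sum_range_sub (fun i => entropyOf P (pastFuture s f g i n)),
    entropyOf_pastFuture_all_left, entropyOf_pastFuture_none]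

theorem entropyOf_pi_le (hP : ∀ ω, 0 ≤ P ω) (hP1 : ∑ ω, P ω = 1) (f : Fin n → Ω → A) :
    entropyOf P (fun ω i => f i ω) ≤ ∑ i, entropyOf P (f i) := by
  have h : ∀ i : Fin n, entropyOf P (pastFuture (fun _ => ()) f f (i + 1) n)
      - entropyOf P (pastFuture (fun _ => ()) f f i n) ≤ entropyOf P (f i) := by
    intro i
    rw [← entropyOf_pastFuture_left]
    linarith [entropyOf_prodMk_le hP hP1 (pastFuture (fun _ => ()) f f i n) (f i)]
  have h2 := Finset.sum_le_sum fun i (_ : i ∈ Finset.univ) => h i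
  rw [Fin.sum_univ_eq_sum_range (fun i => entropyOf P (pastFuture (fun _ => ()) f f (i + 1) n)
    - entropyOf P (pastFuture (fun _ => ()) f f i n)) n,
    Finset.sum_range_sub (fun i => entropyOf P (pastFuture (fun _ => ()) f f i n)),
    entropyOf_pastFuture_all_left, entropyOf_pastFuture_none, entropyOf_const hP1, sub_zero] at h2
  refine le_trans (le_of_eq ?_) h2
  exact entropyOf_congr (by simp)

end Csiszar

/-! ### Convex hulls in finite dimension -/

section ConvexHull

variable {E : Type*} [AddCommGroup E] [Module ℝ E]

/-- Carathéodory's theorem with a fixed number of points. -/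
theorem exists_fin_of_mem_convexHull [FiniteDimensional ℝ E] {s : Set E} {x : E}
    (hx : x ∈ convexHull ℝ s) :
    ∃ w ∈ stdSimplex ℝ (Fin (Module.finrank ℝ E + 1)), ∃ z : Fin (Module.finrank ℝ E + 1) → E,
      (∀ i, z i ∈ s) ∧ ∑ i, w i • z i = x := by
  obtain ⟨ι, _, z, w, hz, hi, hw, hw1, hx⟩ := eq_pos_convex_span_of_mem_convexHull hx
  obtain ⟨e⟩ := Function.Embedding.nonempty_of_card_le
    (α := ι) (β := Fin (Module.finrank ℝ E + 1)) (by
      rw [Fintype.card_fin]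
      exact hi.card_le_finrank_succ.trans (Nat.succ_le_succ (Submodule.finrank_le _)))
  have : Nonempty ι := by
    by_contra h
    rw [not_nonempty_iff] at h
    simp at hw1
  obtain ⟨i₀⟩ := this
  -- Unused slots get weight zero, but their points must still lie in `s`, hence the filler `z i₀`.
  refine ⟨Function.extend e w 0, ⟨fun j => ?_, ?_⟩, Function.extend e z fun _ => z i₀,
    fun j => ?_, ?_⟩
  · by_cases h : ∃ i, e i = j
    · obtain ⟨i, rfl⟩ := h
      rw [e.injective.extend_apply]
      exact (hw i).le
    · rw [Function.extend_apply' _ _ _ h]; rfl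
  · rw [← hw1]
    refine (Fintype.sum_of_injective e e.injective _ _ (fun j hj => ?_) fun i => ?_).symm
    · rw [Function.extend_apply' _ _ _ hj]; rfl
    · rw [e.injective.extend_apply]
  · by_cases h : ∃ i, e i = j
    · obtain ⟨i, rfl⟩ := h
      rw [e.injective.extend_apply]
      exact hz ⟨i, rfl⟩
    · rw [Function.extend_apply' _ _ _ h]
      exact hz ⟨i₀, rfl⟩
  · rw [← hx]
    refine (Fintype.sum_of_injective e e.injective _ _ (fun j hj => ?_) fun i => ?_).symm
    · rw [Function.extend_apply' _ _ _ hj]; simp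
    · rw [e.injective.extend_apply, e.injective.extend_apply]

/-- Since the number of points is fixed, the hull is a continuous image of a simplex times a power
of `s`. -/
theorem isCompact_convexHull [FiniteDimensional ℝ E] [TopologicalSpace E]
    [IsTopologicalAddGroup E] [ContinuousSMul ℝ E] {s : Set E} (hs : IsCompact s) :
    IsCompact (convexHull ℝ s) := by
  have h : convexHull ℝ s = (fun t : (Fin (Module.finrank ℝ E + 1) → ℝ) ×
      (Fin (Module.finrank ℝ E + 1) → E) => ∑ i, t.1 i • t.2 i) ''
        (stdSimplex ℝ _ ×ˢ Set.univ.pi fun _ => s) := by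
    refine Set.Subset.antisymm (fun x hx => ?_) ?_
    · obtain ⟨w, hw, z, hz, rfl⟩ := exists_fin_of_mem_convexHull hx
      exact ⟨(w, z), ⟨hw, fun i _ => hz i⟩, rfl⟩
    · rintro _ ⟨⟨w, z⟩, ⟨hw, hz⟩, rfl⟩
      exact (convex_convexHull ℝ s).sum_mem (fun i _ => hw.1 i) hw.2
        fun i _ => subset_convexHull ℝ s (hz i trivial)
  rw [h]
  refine ((isCompact_stdSimplex ℝ _).prod (isCompact_univ_pi fun _ => hs)).image ?_
  fun_prop

/-- A sum of vectors, each a multiple of a point of `s`, with total mass one. -/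
theorem sum_mem_convexHull {ι : Type*} [Fintype ι] {s : Set E} (c : ι → ℝ) (v : ι → E)
    (hc : ∀ i, 0 ≤ c i) (hc1 : ∑ i, c i = 1) (h0 : ∀ i, c i = 0 → v i = 0)
    (hs : ∀ i, 0 < c i → (c i)⁻¹ • v i ∈ s) : ∑ i, v i ∈ convexHull ℝ s := by
  classical
  have e : ∑ i, v i = ∑ i with c i ≠ 0, c i • (c i)⁻¹ • v i := by
    rw [Finset.sum_filter]
    refine Finset.sum_congr rfl fun i _ => ?_
    split_ifs with h
    · rw [smul_inv_smul₀ h]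
    · exact h0 i (not_not.1 h)
  rw [e]
  refine (convex_convexHull ℝ s).sum_mem (fun i _ => hc i)
    (by rw [Finset.sum_filter_ne_zero, hc1]) fun i hi => subset_convexHull ℝ s (hs i ?_)
  exact (hc i).lt_of_ne' (Finset.mem_filter.1 hi).2

end ConvexHull

/-! ### The conditional entropies of a broadcast channel -/

section EntropySets

variable {X Y Z : Type*} [Fintype Y] [Fintype Z]

namespace BroadcastChannel

/-- The channel to the first receiver. -/
noncomputable def margY (q : BroadcastChannel X Y Z) (x : X) : Y → ℝ := lawOf (q x).1 Prod.fst

/-- The channel to the second receiver. -/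
noncomputable def margZ (q : BroadcastChannel X Y Z) (x : X) : Z → ℝ := lawOf (q x).1 Prod.snd

theorem margY_nonneg (q : BroadcastChannel X Y Z) (x : X) (y : Y) : 0 ≤ q.margY x y :=
  lawOf_nonneg (q x).2.1 _ _

theorem margZ_nonneg (q : BroadcastChannel X Y Z) (x : X) (z : Z) : 0 ≤ q.margZ x z :=
  lawOf_nonneg (q x).2.1 _ _

theorem sum_margY (q : BroadcastChannel X Y Z) (x : X) : ∑ y, q.margY x y = 1 :=
  (sum_lawOf _ _).trans (q x).2.2

theorem sum_margZ (q : BroadcastChannel X Y Z) (x : X) : ∑ z, q.margZ x z = 1 :=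
  (sum_lawOf _ _).trans (q x).2.2

theorem _root_.eq_zero_of_sum_eq_zero_of_nonneg {δ : Type*} [Fintype δ] {mT : δ → X → ℝ}
    (hT : ∀ j x, 0 ≤ mT j x) (hT' : ∑ j, mT j = 0) (j : δ) : mT j = 0 :=
  (Finset.sum_eq_zero_iff_of_nonneg fun j _ => hT j).1 hT' j (Finset.mem_univ j)

variable [Fintype X]

/-- The output entropies at the two receivers. -/
noncomputable def entropies (q : BroadcastChannel X Y Z) (m : X → ℝ) : ℝ × ℝ :=
  (outputEntropy q.margY m, outputEntropy q.margZ m)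

theorem entropies_smul (q : BroadcastChannel X Y Z) (c : ℝ) (m : X → ℝ) :
    q.entropies (c • m) = c • q.entropies m := by
  simp [entropies, outputEntropy_smul q.sum_margY, outputEntropy_smul q.sum_margZ]

@[simp] theorem entropies_zero (q : BroadcastChannel X Y Z) : q.entropies 0 = 0 := by
  simp [entropies]

theorem continuous_entropies (q : BroadcastChannel X Y Z) : Continuous q.entropies :=
  (continuous_outputEntropy _).prodMk (continuous_outputEntropy _)

/-- The input laws with their output entropies. -/
def entropyGraph (q : BroadcastChannel X Y Z) : Set ((X → ℝ) × (ℝ × ℝ)) :=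
  (fun p => (p, q.entropies p)) '' stdSimplex ℝ X

/-- An input law with its output entropies and two pairs of conditional output entropies. -/
def condEntropyGraph (q : BroadcastChannel X Y Z) :
    Set ((X → ℝ) × (ℝ × ℝ) × (ℝ × ℝ) × (ℝ × ℝ)) :=
  {κ | κ.1 ∈ stdSimplex ℝ X ∧ κ.2.1 = q.entropies κ.1 ∧
    (κ.1, κ.2.2.1) ∈ convexHull ℝ q.entropyGraph ∧ (κ.1, κ.2.2.2) ∈ convexHull ℝ q.entropyGraph}

/-- The possible values of the input law and of the conditional output entropies given `W`,
given `(W, U)` and given `(W, V)`. -/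
def entropySet (q : BroadcastChannel X Y Z) : Set ((X → ℝ) × (ℝ × ℝ) × (ℝ × ℝ) × (ℝ × ℝ)) :=
  convexHull ℝ q.condEntropyGraph

/-- A continuous image of the fibre product of two copies of the compact inner hull over a common
input law. -/
theorem isCompact_condEntropyGraph (q : BroadcastChannel X Y Z) :
    IsCompact q.condEntropyGraph := by
  have hG : IsCompact (convexHull ℝ q.entropyGraph) :=
    isCompact_convexHull ((isCompact_stdSimplex ℝ X).image
      (continuous_id.prodMk q.continuous_entropies))
  have h : q.condEntropyGraph = (fun t : ((X → ℝ) × (ℝ × ℝ)) × ((X → ℝ) × (ℝ × ℝ)) =>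
      (t.1.1, q.entropies t.1.1, t.1.2, t.2.2)) ''
      ((convexHull ℝ q.entropyGraph ×ˢ convexHull ℝ q.entropyGraph) ∩
        {t | t.1.1 = t.2.1 ∧ t.1.1 ∈ stdSimplex ℝ X}) := by
    ext ⟨p, a, b, c⟩
    constructor
    · rintro ⟨h1, h2, h3, h4⟩
      exact ⟨((p, b), (p, c)), ⟨⟨h3, h4⟩, rfl, h1⟩, by simp only at h2; simp [h2]⟩
    · rintro ⟨⟨⟨p1, b1⟩, ⟨p2, b2⟩⟩, ⟨⟨h3, h4⟩, h5, h1⟩, h6⟩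
      simp only [Prod.mk.injEq] at h6 h5 h1
      obtain ⟨rfl, rfl, rfl, rfl⟩ := h6
      subst h5
      exact ⟨h1, rfl, h3, h4⟩
  rw [h]
  refine ((hG.prod hG).inter_right ?_).image ?_
  · exact (isClosed_eq (by fun_prop) (by fun_prop)).inter
      ((isClosed_stdSimplex ℝ X).preimage (f := fun t : ((X → ℝ) × (ℝ × ℝ)) × ((X → ℝ) × (ℝ × ℝ))
        => t.1.1) (by fun_prop))
  · have := q.continuous_entropies
    fun_prop

theorem isCompact_entropySet (q : BroadcastChannel X Y Z) : IsCompact q.entropySet :=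
  isCompact_convexHull q.isCompact_condEntropyGraph

theorem sum_mem_convexHull_entropyGraph {ι : Type*} [Fintype ι] (q : BroadcastChannel X Y Z)
    (m : ι → X → ℝ) (hm : ∀ i x, 0 ≤ m i x) (hm1 : ∑ i, ∑ x, m i x = 1) :
    (∑ i, m i, ∑ i, q.entropies (m i)) ∈ convexHull ℝ q.entropyGraph := by
  have e : (∑ i, m i, ∑ i, q.entropies (m i)) = ∑ i, (m i, q.entropies (m i)) := by
    rw [Prod.ext_iff, Prod.fst_sum, Prod.snd_sum]
    exact ⟨rfl, rfl⟩
  rw [e]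
  refine sum_mem_convexHull (fun i => ∑ x, m i x) _ (fun i => Finset.sum_nonneg fun x _ => hm i x)
    hm1 (fun i hi => ?_) fun i hi => ?_
  · have h0 : m i = 0 := funext fun x =>
      (Finset.sum_eq_zero_iff_of_nonneg fun x _ => hm i x).1 hi x (Finset.mem_univ x)
    simp [h0]
  · refine ⟨(∑ x, m i x)⁻¹ • m i, ⟨fun x => mul_nonneg (inv_nonneg.2 hi.le) (hm i x), ?_⟩, ?_⟩
    · simp only [Pi.smul_apply, smul_eq_mul, ← Finset.mul_sum]
      exact inv_mul_cancel₀ hi.ne'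
    · simp [entropies_smul]

theorem inv_smul_mem_convexHull_entropyGraph {δ : Type*} [Fintype δ] (q : BroadcastChannel X Y Z)
    (m : X → ℝ) (mT : δ → X → ℝ) (hT : ∀ j x, 0 ≤ mT j x) (hT' : ∑ j, mT j = m)
    (hm : 0 < ∑ x, m x) :
    ((∑ x, m x)⁻¹ • m, (∑ x, m x)⁻¹ • ∑ j, q.entropies (mT j)) ∈ convexHull ℝ q.entropyGraph := by
  have := q.sum_mem_convexHull_entropyGraph (fun j => (∑ x, m x)⁻¹ • mT j)
    (fun j x => mul_nonneg (inv_nonneg.2 hm.le) (hT j x)) (by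
      simp only [Pi.smul_apply, smul_eq_mul, ← Finset.mul_sum]
      rw [Finset.sum_comm]
      simp only [← Finset.sum_apply _ _ mT, hT']
      exact inv_mul_cancel₀ hm.ne')
  simpa only [entropies_smul, ← Finset.smul_sum, hT'] using this

/-- The index `i` is the value of W, with unnormalized input measure `m i`. Normalizing it lands in
`condEntropyGraph`, where the refinements by U and by V use separate hulls and need no coupling. -/
theorem sum_mem_entropySet {ι β γ : Type*} [Fintype ι] [Fintype β] [Fintype γ]
    (q : BroadcastChannel X Y Z) (m : ι → X → ℝ) (mU : ι → β → X → ℝ) (mV : ι → γ → X → ℝ)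
    (hU : ∀ i j x, 0 ≤ mU i j x) (hV : ∀ i j x, 0 ≤ mV i j x)
    (hU' : ∀ i, ∑ j, mU i j = m i) (hV' : ∀ i, ∑ j, mV i j = m i) (hm1 : ∑ i, ∑ x, m i x = 1) :
    (∑ i, m i, ∑ i, q.entropies (m i), ∑ i, ∑ j, q.entropies (mU i j),
      ∑ i, ∑ j, q.entropies (mV i j)) ∈ q.entropySet := by
  have hm : ∀ i x, 0 ≤ m i x := by
    intro i x
    rw [← hU' i, Finset.sum_apply]
    exact Finset.sum_nonneg fun j _ => hU i j x
  have e : (∑ i, m i, ∑ i, q.entropies (m i), ∑ i, ∑ j, q.entropies (mU i j),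
      ∑ i, ∑ j, q.entropies (mV i j)) = ∑ i, (m i, q.entropies (m i),
        ∑ j, q.entropies (mU i j), ∑ j, q.entropies (mV i j)) := by
    simp only [Prod.ext_iff, Prod.fst_sum, Prod.snd_sum]
    simp
  rw [e]
  refine sum_mem_convexHull (fun i => ∑ x, m i x) _ (fun i => Finset.sum_nonneg fun x _ => hm i x)
    hm1 (fun i hi => ?_) fun i hi => ?_
  · have h0 : m i = 0 := funext fun x =>
      (Finset.sum_eq_zero_iff_of_nonneg fun x _ => hm i x).1 hi x (Finset.mem_univ x)
    simp [h0, eq_zero_of_sum_eq_zero_of_nonneg (hU i) ((hU' i).trans h0),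
      eq_zero_of_sum_eq_zero_of_nonneg (hV i) ((hV' i).trans h0)]
  · refine ⟨⟨fun x => mul_nonneg (inv_nonneg.2 hi.le) (hm i x), ?_⟩, ?_,
      q.inv_smul_mem_convexHull_entropyGraph _ _ (hU i) (hU' i) hi,
      q.inv_smul_mem_convexHull_entropyGraph _ _ (hV i) (hV' i) hi⟩
    · simp only [Prod.smul_fst, Pi.smul_apply, smul_eq_mul, ← Finset.mul_sum]
      exact inv_mul_cancel₀ hi.ne'
    · simp [entropies_smul]

theorem sum_sum_entropies_lawOf {Ω S T D : Type*} [Fintype Ω] [Fintype S] [Fintype T] [Fintype D]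
    (q : BroadcastChannel X Y Z) {P : Ω → ℝ} {w : Ω → S} {d : Ω → D} {wd : Ω → T} {x : Ω → X}
    {y : Ω → Y} {z : Ω → Z} (h : ∀ ω ω', wd ω = wd ω' ↔ w ω = w ω' ∧ d ω = d ω')
    (hY : IsOutput P (fun ω => (w ω, d ω)) x y q.margY)
    (hZ : IsOutput P (fun ω => (w ω, d ω)) x z q.margZ) :
    ∑ s, ∑ b, q.entropies (fun a => lawOf P (fun ω => ((w ω, d ω), x ω)) ((s, b), a))
      = (entropyOf P (fun ω => (wd ω, y ω)) - entropyOf P wd,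
        entropyOf P (fun ω => (wd ω, z ω)) - entropyOf P wd) := by
  rw [entropyOf_congr (f := wd) (g := fun ω => (w ω, d ω)) (by simpa using h),
    entropyOf_congr (f := fun ω => (wd ω, y ω)) (g := fun ω => ((w ω, d ω), y ω))
      (by simp [h]),
    entropyOf_congr (f := fun ω => (wd ω, z ω)) (g := fun ω => ((w ω, d ω), z ω))
      (by simp [h]), hY.entropyOf_sub, hZ.entropyOf_sub,
    ← Fintype.sum_prod_type' (f := fun s b =>
      q.entropies (fun a => lawOf P (fun ω => ((w ω, d ω), x ω)) ((s, b), a))),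
    Prod.ext_iff, Prod.fst_sum, Prod.snd_sum]
  exact ⟨rfl, rfl⟩

/-- Only the laws of (w, u, x) and (w, v, x) are used, so the dependence between `u` and `v` is
forgotten. The variables `wu` and `wv` are given up to the partition they generate, since in the
application `u` and `v` sit inside the tuple of past and future. -/
theorem condEntropies_mem_entropySet {Ω S β γ S' S'' : Type*} [Fintype Ω] [Fintype S] [Fintype β]
    [Fintype γ] [Fintype S'] [Fintype S''] (q : BroadcastChannel X Y Z) {P : Ω → ℝ}
    (hP : ∀ ω, 0 ≤ P ω) (hP1 : ∑ ω, P ω = 1) (w : Ω → S) (u : Ω → β) (v : Ω → γ)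
    (wu : Ω → S') (wv : Ω → S'') (x : Ω → X) (y : Ω → Y) (z : Ω → Z)
    (hwu : ∀ ω ω', wu ω = wu ω' ↔ w ω = w ω' ∧ u ω = u ω')
    (hwv : ∀ ω ω', wv ω = wv ω' ↔ w ω = w ω' ∧ v ω = v ω')
    (hY : IsOutput P (fun ω => (w ω, u ω, v ω)) x y q.margY)
    (hZ : IsOutput P (fun ω => (w ω, u ω, v ω)) x z q.margZ) :
    (lawOf P x,
      (entropyOf P (fun ω => (w ω, y ω)) - entropyOf P w,
        entropyOf P (fun ω => (w ω, z ω)) - entropyOf P w),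
      (entropyOf P (fun ω => (wu ω, y ω)) - entropyOf P wu,
        entropyOf P (fun ω => (wu ω, z ω)) - entropyOf P wu),
      (entropyOf P (fun ω => (wv ω, y ω)) - entropyOf P wv,
        entropyOf P (fun ω => (wv ω, z ω)) - entropyOf P wv)) ∈ q.entropySet := by
  have key := q.sum_mem_entropySet (fun s a => lawOf P (fun ω => (w ω, x ω)) (s, a))
    (fun s b a => lawOf P (fun ω => ((w ω, u ω), x ω)) ((s, b), a))
    (fun s b a => lawOf P (fun ω => ((w ω, v ω), x ω)) ((s, b), a))
    (fun _ _ _ => lawOf_nonneg hP _ _) (fun _ _ _ => lawOf_nonneg hP _ _)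
    (fun s => by
      funext a
      rw [Finset.sum_apply, ← sum_lawOf_prodMk P (fun ω => (w ω, x ω)) u]
      exact Finset.sum_congr rfl fun b _ => lawOf_congr fun ω => by
        simp only [Prod.mk.injEq]; tauto)
    (fun s => by
      funext a
      rw [Finset.sum_apply, ← sum_lawOf_prodMk P (fun ω => (w ω, x ω)) v]
      exact Finset.sum_congr rfl fun b _ => lawOf_congr fun ω => by
        simp only [Prod.mk.injEq]; tauto)
    (by rw [← hP1, ← sum_lawOf P (fun ω => (w ω, x ω)), Fintype.sum_prod_type])
  have ex : ∑ s, (fun a => lawOf P (fun ω => (w ω, x ω)) (s, a)) = lawOf P x := by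
    funext a
    rw [Finset.sum_apply, sum_lawOf_prodMk_left]
  have e1 : ∑ s, q.entropies (fun a => lawOf P (fun ω => (w ω, x ω)) (s, a))
      = (entropyOf P (fun ω => (w ω, y ω)) - entropyOf P w,
        entropyOf P (fun ω => (w ω, z ω)) - entropyOf P w) := by
    rw [(hY.map Prod.fst).entropyOf_sub, (hZ.map Prod.fst).entropyOf_sub, Prod.ext_iff,
      Prod.fst_sum, Prod.snd_sum]
    exact ⟨rfl, rfl⟩
  rwa [ex, e1, q.sum_sum_entropies_lawOf hwu (hY.map fun t => (t.1, t.2.1))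
    (hZ.map fun t => (t.1, t.2.1)),
    q.sum_sum_entropies_lawOf hwv (hY.map fun t => (t.1, t.2.2))
    (hZ.map fun t => (t.1, t.2.2))] at key

end BroadcastChannel

end EntropySets

/-! ### Realization of the points of the entropy set by finite auxiliary variables -/

section Realization

variable {W V U X Y Z : Type*} [Fintype W] [Fintype V] [Fintype U] [Fintype X] [Fintype Y]
  [Fintype Z]

theorem lawOf_jointLaw_input {A : Type*} (p : W × V × U × X → ℝ) (q : BroadcastChannel X Y Z)
    (f : W × V × U × X → A) (a : A) : lawOf (jointLaw p q) (fun ω => f ω.1) a = lawOf p f a := by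
  unfold lawOf jointLaw
  rw [Fintype.sum_prod_type]
  refine Finset.sum_congr rfl fun r _ => ?_
  by_cases h : f r = a
  · simp only [h, if_true, ← Finset.mul_sum, (q _).2.2, mul_one]
  · simp [h]

theorem isOutput_jointLaw_fst {A : Type*} (p : W × V × U × X → ℝ) (q : BroadcastChannel X Y Z)
    (f : W × V × U × X → A) : IsOutput (jointLaw p q) (fun ω => f ω.1) (fun ω => ω.1.2.2.2)
      (fun ω => ω.2.1) q.margY :=
  isOutput_of_equiv (Equiv.refl _) p (fun r => r.2.2.2) (fun x => (q x).1) (fun x => (q x).2.2)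
    Prod.fst (fun _ _ => rfl) (fun _ _ _ => rfl) (fun _ _ => rfl) (fun _ _ => rfl)

theorem isOutput_jointLaw_snd {A : Type*} (p : W × V × U × X → ℝ) (q : BroadcastChannel X Y Z)
    (f : W × V × U × X → A) : IsOutput (jointLaw p q) (fun ω => f ω.1) (fun ω => ω.1.2.2.2)
      (fun ω => ω.2.2) q.margZ :=
  isOutput_of_equiv (Equiv.refl _) p (fun r => r.2.2.2) (fun x => (q x).1) (fun x => (q x).2.2)
    Prod.snd (fun _ _ => rfl) (fun _ _ _ => rfl) (fun _ _ => rfl) (fun _ _ => rfl)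

theorem sum_jointLaw (p : W × V × U × X → ℝ) (q : BroadcastChannel X Y Z) :
    ∑ ω, jointLaw p q ω = ∑ r, p r := by
  simpa [lawOf] using lawOf_jointLaw_input p q (fun _ => ()) ()

/-- This and the next five formulas express the information terms through the laws of (W, X), (W, U,
X) and (W, V, X) alone. -/
theorem infoWY_eq {p : W × V × U × X → ℝ} (hp : ∑ r, p r = 1) (q : BroadcastChannel X Y Z) :
    infoWY p q = outputEntropy q.margY (lawOf p fun r => r.2.2.2)
    - ∑ w, outputEntropy q.margY fun x => lawOf p (fun r => (r.1, r.2.2.2)) (w, x) := by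
  have h1 := (isOutput_jointLaw_fst p q fun r => r.1).entropyOf_sub
  have h2 := (isOutput_jointLaw_fst p q fun _ => ()).entropyOf_eq ((sum_jointLaw p q).trans hp)
  simp only [lawOf_jointLaw_input p q fun r => (r.1, r.2.2.2)] at h1
  rw [funext (lawOf_jointLaw_input p q fun r => r.2.2.2)] at h2
  unfold infoWY mutInfo
  linarith

theorem infoWZ_eq {p : W × V × U × X → ℝ} (hp : ∑ r, p r = 1) (q : BroadcastChannel X Y Z) :
    infoWZ p q = outputEntropy q.margZ (lawOf p fun r => r.2.2.2)
    - ∑ w, outputEntropy q.margZ fun x => lawOf p (fun r => (r.1, r.2.2.2)) (w, x) := by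
  have h1 := (isOutput_jointLaw_snd p q fun r => r.1).entropyOf_sub
  have h2 := (isOutput_jointLaw_snd p q fun _ => ()).entropyOf_eq ((sum_jointLaw p q).trans hp)
  simp only [lawOf_jointLaw_input p q fun r => (r.1, r.2.2.2)] at h1
  rw [funext (lawOf_jointLaw_input p q fun r => r.2.2.2)] at h2
  unfold infoWZ mutInfo
  linarith

theorem infoUY_eq (p : W × V × U × X → ℝ) (q : BroadcastChannel X Y Z) :
    infoUY p q = (∑ w, outputEntropy q.margY fun x => lawOf p (fun r => (r.1, r.2.2.2)) (w, x))
      - ∑ t, outputEntropy q.margY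
        fun x => lawOf p (fun r => ((r.1, r.2.2.1), r.2.2.2)) (t, x) := by
  have h1 := (isOutput_jointLaw_fst p q fun r => r.1).entropyOf_sub
  have h2 := (isOutput_jointLaw_fst p q fun r => (r.1, r.2.2.1)).entropyOf_sub
  simp only [lawOf_jointLaw_input p q fun r => (r.1, r.2.2.2),
    lawOf_jointLaw_input p q fun r => ((r.1, r.2.2.1), r.2.2.2)] at h1 h2
  rw [← h1, ← h2]
  unfold infoUY condMutInfo
  rw [entropyOf_congr (f := fun ω : (W × V × U × X) × (Y × Z) => (ω.1.2.2.1, ω.1.1))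
      (g := fun ω => (ω.1.1, ω.1.2.2.1)) (by simp; tauto),
    entropyOf_congr (f := fun ω : (W × V × U × X) × (Y × Z) => (ω.2.1, ω.1.1))
      (g := fun ω => (ω.1.1, ω.2.1)) (by simp; tauto),
    entropyOf_congr (f := fun ω : (W × V × U × X) × (Y × Z) => (ω.1.2.2.1, ω.2.1, ω.1.1))
      (g := fun ω => ((ω.1.1, ω.1.2.2.1), ω.2.1)) (by simp; tauto)]
  ring

theorem infoVZ_eq (p : W × V × U × X → ℝ) (q : BroadcastChannel X Y Z) :
    infoVZ p q = (∑ w, outputEntropy q.margZ fun x => lawOf p (fun r => (r.1, r.2.2.2)) (w, x))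
      - ∑ t, outputEntropy q.margZ
        fun x => lawOf p (fun r => ((r.1, r.2.1), r.2.2.2)) (t, x) := by
  have h1 := (isOutput_jointLaw_snd p q fun r => r.1).entropyOf_sub
  have h2 := (isOutput_jointLaw_snd p q fun r => (r.1, r.2.1)).entropyOf_sub
  simp only [lawOf_jointLaw_input p q fun r => (r.1, r.2.2.2),
    lawOf_jointLaw_input p q fun r => ((r.1, r.2.1), r.2.2.2)] at h1 h2
  rw [← h1, ← h2]
  unfold infoVZ condMutInfo
  rw [entropyOf_congr (f := fun ω : (W × V × U × X) × (Y × Z) => (ω.1.2.1, ω.1.1))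
      (g := fun ω => (ω.1.1, ω.1.2.1)) (by simp; tauto),
    entropyOf_congr (f := fun ω : (W × V × U × X) × (Y × Z) => (ω.2.2, ω.1.1))
      (g := fun ω => (ω.1.1, ω.2.2)) (by simp; tauto),
    entropyOf_congr (f := fun ω : (W × V × U × X) × (Y × Z) => (ω.1.2.1, ω.2.2, ω.1.1))
      (g := fun ω => ((ω.1.1, ω.1.2.1), ω.2.2)) (by simp; tauto)]
  ring

theorem infoXZ_eq (p : W × V × U × X → ℝ) (q : BroadcastChannel X Y Z) :
    infoXZ p q = (∑ t, outputEntropy q.margZ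
        fun x => lawOf p (fun r => ((r.1, r.2.2.1), r.2.2.2)) (t, x))
      - noiseEntropy q.margZ (lawOf p fun r => r.2.2.2) := by
  have h1 := (isOutput_jointLaw_snd p q fun r => (r.1, r.2.2.1)).entropyOf_sub
  have h2 := (isOutput_jointLaw_snd p q fun r => (r.2.2.2, r.2.2.1, r.1)).entropyOf_sub_of_determines
    q.sum_margZ Prod.fst fun _ => rfl
  simp only [lawOf_jointLaw_input p q fun r => ((r.1, r.2.2.1), r.2.2.2)] at h1
  rw [funext (lawOf_jointLaw_input p q fun r => r.2.2.2)] at h2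
  rw [← h1, ← h2]
  unfold infoXZ condMutInfo
  rw [entropyOf_congr (f := fun ω : (W × V × U × X) × (Y × Z) => (ω.1.2.2.1, ω.1.1))
      (g := fun ω => (ω.1.1, ω.1.2.2.1)) (by simp; tauto),
    entropyOf_congr (f := fun ω : (W × V × U × X) × (Y × Z) => (ω.2.2, ω.1.2.2.1, ω.1.1))
      (g := fun ω => ((ω.1.1, ω.1.2.2.1), ω.2.2)) (by simp; tauto),
    entropyOf_congr
      (f := fun ω : (W × V × U × X) × (Y × Z) => (ω.1.2.2.2, ω.2.2, ω.1.2.2.1, ω.1.1))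
      (g := fun ω => ((ω.1.2.2.2, ω.1.2.2.1, ω.1.1), ω.2.2)) (by simp; tauto)]
  ring

theorem infoXY_eq (p : W × V × U × X → ℝ) (q : BroadcastChannel X Y Z) :
    infoXY p q = (∑ t, outputEntropy q.margY
        fun x => lawOf p (fun r => ((r.1, r.2.1), r.2.2.2)) (t, x))
      - noiseEntropy q.margY (lawOf p fun r => r.2.2.2) := by
  have h1 := (isOutput_jointLaw_fst p q fun r => (r.1, r.2.1)).entropyOf_sub
  have h2 := (isOutput_jointLaw_fst p q fun r => (r.2.2.2, r.2.1, r.1)).entropyOf_sub_of_determines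
    q.sum_margY Prod.fst fun _ => rfl
  simp only [lawOf_jointLaw_input p q fun r => ((r.1, r.2.1), r.2.2.2)] at h1
  rw [funext (lawOf_jointLaw_input p q fun r => r.2.2.2)] at h2
  rw [← h1, ← h2]
  unfold infoXY condMutInfo
  rw [entropyOf_congr (f := fun ω : (W × V × U × X) × (Y × Z) => (ω.1.2.1, ω.1.1))
      (g := fun ω => (ω.1.1, ω.1.2.1)) (by simp; tauto),
    entropyOf_congr (f := fun ω : (W × V × U × X) × (Y × Z) => (ω.2.1, ω.1.2.1, ω.1.1))
      (g := fun ω => ((ω.1.1, ω.1.2.1), ω.2.1)) (by simp; tauto),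
    entropyOf_congr
      (f := fun ω : (W × V × U × X) × (Y × Z) => (ω.1.2.2.2, ω.2.1, ω.1.2.1, ω.1.1))
      (g := fun ω => ((ω.1.2.2.2, ω.1.2.1, ω.1.1), ω.2.1)) (by simp; tauto)]
  ring

/-- Two families of measures with the same marginals are glued to a joint law. -/
theorem exists_glued_law (mU : W → U → X → ℝ) (mV : W → V → X → ℝ) (m : W → X → ℝ)
    (hU : ∀ w u x, 0 ≤ mU w u x) (hV : ∀ w v x, 0 ≤ mV w v x)
    (hU' : ∀ w, ∑ u, mU w u = m w) (hV' : ∀ w, ∑ v, mV w v = m w) (hm1 : ∑ w, ∑ x, m w x = 1) :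
    ∃ p ∈ stdSimplex ℝ (W × V × U × X),
      (∀ w u x, lawOf p (fun r => ((r.1, r.2.2.1), r.2.2.2)) ((w, u), x) = mU w u x) ∧
      (∀ w v x, lawOf p (fun r => ((r.1, r.2.1), r.2.2.2)) ((w, v), x) = mV w v x) ∧
      (∀ w x, lawOf p (fun r => (r.1, r.2.2.2)) (w, x) = m w x) ∧
      lawOf p (fun r => r.2.2.2) = ∑ w, m w := by
  classical
  have hU'' : ∀ w x, ∑ u, mU w u x = m w x := fun w x => by
    rw [← Finset.sum_apply, hU']
  have hV'' : ∀ w x, ∑ v, mV w v x = m w x := fun w x => by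
    rw [← Finset.sum_apply, hV']
  have hm : ∀ w x, 0 ≤ m w x := fun w x => by
    rw [← hU'']; exact Finset.sum_nonneg fun u _ => hU w u x
  have cancelU : ∀ w u x, mU w u x * m w x / m w x = mU w u x := by
    intro w u x
    refine mul_div_cancel_of_imp fun h0 => ?_
    rw [← hU''] at h0
    exact (Finset.sum_eq_zero_iff_of_nonneg fun u _ => hU w u x).1 h0 u (Finset.mem_univ u)
  have cancelV : ∀ w v x, m w x * mV w v x / m w x = mV w v x := by
    intro w v x
    rw [mul_comm]
    refine mul_div_cancel_of_imp fun h0 => ?_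
    rw [← hV''] at h0
    exact (Finset.sum_eq_zero_iff_of_nonneg fun v _ => hV w v x).1 h0 v (Finset.mem_univ v)
  -- U and V are made conditionally independent given (W, X). Where `m` vanishes so do `mU` and
  -- `mV`, so division by zero does no harm.
  let p : W × V × U × X → ℝ := fun r =>
    mU r.1 r.2.2.1 r.2.2.2 * mV r.1 r.2.1 r.2.2.2 / m r.1 r.2.2.2
  have h1 : ∀ w u x, lawOf p (fun r => ((r.1, r.2.2.1), r.2.2.2)) ((w, u), x) = mU w u x := by
    intro w u x
    rw [← cancelU, ← hV'', Finset.mul_sum, Finset.sum_div]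
    simp [lawOf, Fintype.sum_prod_type, ite_and, p, hV'']
  have h2 : ∀ w v x, lawOf p (fun r => ((r.1, r.2.1), r.2.2.2)) ((w, v), x) = mV w v x := by
    intro w v x
    rw [← cancelV, ← hU'', Finset.sum_mul, Finset.sum_div]
    simp [lawOf, Fintype.sum_prod_type, ite_and, p, hU'']
  have h3 : ∀ w x, lawOf p (fun r => (r.1, r.2.2.2)) (w, x) = m w x := by
    intro w x
    rw [← hU'', ← sum_lawOf_prodMk p _ fun r => r.2.2.1]
    refine Finset.sum_congr rfl fun u _ => ?_
    rw [← h1]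
    exact lawOf_congr fun r => by simp only [Prod.mk.injEq]; tauto
  have h4 : lawOf p (fun r => r.2.2.2) = ∑ w, m w := by
    funext x
    rw [Finset.sum_apply, ← sum_lawOf_prodMk_left p (fun r => r.1)]
    exact Finset.sum_congr rfl fun w _ => h3 w x
  refine ⟨p, ⟨fun r => div_nonneg (mul_nonneg (hU _ _ _) (hV _ _ _)) (hm _ _), ?_⟩, h1, h2, h3, h4⟩
  rw [← sum_lawOf p fun r => r.2.2.2, h4, ← hm1, Finset.sum_comm]
  simp

end Realization

namespace BroadcastChannel

variable {X Y Z : Type*} [Fintype X] [Fintype Y] [Fintype Z]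

/-- Carathéodory at two levels: the weights of the outer hull are the law of W, those of the inner
hulls the conditional laws of U and of V given W. -/
theorem exists_of_mem_entropySet (q : BroadcastChannel X Y Z)
    {κ : (X → ℝ) × (ℝ × ℝ) × (ℝ × ℝ) × (ℝ × ℝ)} (hκ : κ ∈ q.entropySet) :
    ∃ a b c : ℕ, ∃ p ∈ stdSimplex ℝ (Fin a × Fin b × Fin c × X),
      infoWY p q = outputEntropy q.margY κ.1 - κ.2.1.1 ∧
      infoWZ p q = outputEntropy q.margZ κ.1 - κ.2.1.2 ∧
      infoUY p q = κ.2.1.1 - κ.2.2.1.1 ∧ infoVZ p q = κ.2.1.2 - κ.2.2.2.2 ∧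
      infoXZ p q = κ.2.2.1.2 - noiseEntropy q.margZ κ.1 ∧
      infoXY p q = κ.2.2.2.1 - noiseEntropy q.margY κ.1 := by
  obtain ⟨c, hc, z, hz, rfl⟩ := exists_fin_of_mem_convexHull hκ
  choose μ hμ g hg hgz using fun i => exists_fin_of_mem_convexHull (hz i).2.2.1
  choose ν hν h hh hhz using fun i => exists_fin_of_mem_convexHull (hz i).2.2.2
  have hg1 : ∀ i j, (g i j).1 ∈ stdSimplex ℝ X ∧ (g i j).2 = q.entropies (g i j).1 := by
    intro i j
    obtain ⟨p, hp, hpg⟩ := hg i j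
    rw [← hpg]; exact ⟨hp, rfl⟩
  have hh1 : ∀ i j, (h i j).1 ∈ stdSimplex ℝ X ∧ (h i j).2 = q.entropies (h i j).1 := by
    intro i j
    obtain ⟨p, hp, hpg⟩ := hh i j
    rw [← hpg]; exact ⟨hp, rfl⟩
  simp only [Prod.ext_iff, Prod.fst_sum, Prod.snd_sum, Prod.smul_fst, Prod.smul_snd,
    (hg1 _ _).2, (hh1 _ _).2] at hgz hhz
  obtain ⟨p, hp, h1, h2, h3, h4⟩ := exists_glued_law
    (fun i j => c i • μ i j • (g i j).1) (fun i j => c i • ν i j • (h i j).1)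
    (fun i => c i • (z i).1)
    (fun i j x => mul_nonneg (hc.1 i) (mul_nonneg ((hμ i).1 j) ((hg1 i j).1.1 x)))
    (fun i j x => mul_nonneg (hc.1 i) (mul_nonneg ((hν i).1 j) ((hh1 i j).1.1 x)))
    (fun i => by rw [← Finset.smul_sum, (hgz i).1]) (fun i => by rw [← Finset.smul_sum, (hhz i).1])
    (by simp only [Pi.smul_apply, smul_eq_mul, ← Finset.mul_sum, (hz _).1.2, mul_one]; exact hc.2)
  refine ⟨_, _, _, p, hp, ?_⟩
  have eW : ∀ i, (fun x => lawOf p (fun r => (r.1, r.2.2.2)) (i, x)) = c i • (z i).1 :=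
    fun i => funext (h3 i)
  have eU : ∀ i j, (fun x => lawOf p (fun r => ((r.1, r.2.2.1), r.2.2.2)) ((i, j), x))
      = c i • μ i j • (g i j).1 := fun i j => funext (h1 i j)
  have eV : ∀ i j, (fun x => lawOf p (fun r => ((r.1, r.2.1), r.2.2.2)) ((i, j), x))
      = c i • ν i j • (h i j).1 := fun i j => funext (h2 i j)
  rw [infoWY_eq hp.2, infoWZ_eq hp.2, infoUY_eq, infoVZ_eq, infoXZ_eq, infoXY_eq]
  simp only [Fintype.sum_prod_type, eW, eU, eV, h4, outputEntropy_smul q.sum_margY,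
    outputEntropy_smul q.sum_margZ, ← Finset.mul_sum]
  have kW := fun i => (hz i).2.1
  simp only [Prod.ext_iff, entropies, smul_eq_mul] at kW hgz hhz
  simp only [Prod.fst_sum, Prod.snd_sum, Prod.smul_fst, Prod.smul_snd, smul_eq_mul, (hgz _).2.1,
    (hgz _).2.2, (hhz _).2.1, (hhz _).2.2, (kW _).1, (kW _).2, and_self]

end BroadcastChannel

/-! ### The outer bound in terms of conditional entropies -/

namespace BroadcastChannel

section Terms

variable {X Y Z : Type*} [Fintype X] [Fintype Y] [Fintype Z] (q : BroadcastChannel X Y Z)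
  (κ : (X → ℝ) × (ℝ × ℝ) × (ℝ × ℝ) × (ℝ × ℝ))

/-- `I(W; Y)` -/
noncomputable def termWY : ℝ := outputEntropy q.margY κ.1 - κ.2.1.1

/-- `I(W; Z)` -/
noncomputable def termWZ : ℝ := outputEntropy q.margZ κ.1 - κ.2.1.2

/-- `I(U; Y | W)` and `I(X; Z | U, W)` added up -/
noncomputable def termUYXZ : ℝ := κ.2.1.1 - κ.2.2.1.1 + (κ.2.2.1.2 - noiseEntropy q.margZ κ.1)

/-- `I(V; Z | W)` and `I(X; Y | V, W)` added up -/
noncomputable def termVZXY : ℝ := κ.2.1.2 - κ.2.2.2.2 + (κ.2.2.2.1 - noiseEntropy q.margY κ.1)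

theorem fst_mem_stdSimplex {κ : (X → ℝ) × (ℝ × ℝ) × (ℝ × ℝ) × (ℝ × ℝ)} (hκ : κ ∈ q.entropySet) :
    κ.1 ∈ stdSimplex ℝ X := by
  have h : q.condEntropyGraph ⊆ (LinearMap.fst ℝ (X → ℝ) ((ℝ × ℝ) × (ℝ × ℝ) × (ℝ × ℝ))) ⁻¹'
      stdSimplex ℝ X := fun κ hκ => hκ.1
  exact convexHull_min h ((convex_stdSimplex ℝ X).linear_preimage _) hκ

/-- Time sharing. -/
theorem exists_average {n : ℕ} (hn : 0 < n)
    {κ : Fin n → (X → ℝ) × (ℝ × ℝ) × (ℝ × ℝ) × (ℝ × ℝ)} (hκ : ∀ i, κ i ∈ q.entropySet) :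
    ∃ κ' ∈ q.entropySet, ∑ i, q.termWY (κ i) ≤ n * q.termWY κ' ∧
      ∑ i, q.termWZ (κ i) ≤ n * q.termWZ κ' ∧
      ∑ i, ((κ i).2.1.1 - (κ i).2.2.1.1) = n * (κ'.2.1.1 - κ'.2.2.1.1) ∧
      ∑ i, ((κ i).2.1.2 - (κ i).2.2.2.2) = n * (κ'.2.1.2 - κ'.2.2.2.2) ∧
      ∑ i, q.termUYXZ (κ i) = n * q.termUYXZ κ' ∧ ∑ i, q.termVZXY (κ i) = n * q.termVZXY κ' := by
  have hn' : (n : ℝ) ≠ 0 := by positivity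
  have hw : ∑ _i : Fin n, (n : ℝ)⁻¹ = 1 := by simp [hn']
  have hw0 : ∀ i ∈ (Finset.univ : Finset (Fin n)), (0 : ℝ) ≤ (n : ℝ)⁻¹ := fun _ _ => by positivity
  refine ⟨∑ i, (n : ℝ)⁻¹ • κ i, (convex_convexHull ℝ _).sum_mem hw0 hw fun i _ => hκ i, ?_⟩
  -- H(Y) and H(Z) are the only terms not affine along the average; concavity gives the inequality
  -- in the direction an outer bound needs.
  have hY := (concaveOn_outputEntropy q.margY_nonneg).le_map_sum hw0 hw
    fun i _ => q.fst_mem_stdSimplex (hκ i)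
  have hZ := (concaveOn_outputEntropy q.margZ_nonneg).le_map_sum hw0 hw
    fun i _ => q.fst_mem_stdSimplex (hκ i)
  simp only [← Finset.smul_sum, smul_eq_mul, ← Finset.mul_sum] at hY hZ ⊢
  rw [inv_mul_le_iff₀ (by positivity)] at hY hZ
  have hNY := noiseEntropy_sum Finset.univ q.margY (n : ℝ)⁻¹ fun i => (κ i).1
  have hNZ := noiseEntropy_sum Finset.univ q.margZ (n : ℝ)⁻¹ fun i => (κ i).1
  simp only [termWY, termWZ, termUYXZ, termVZXY, Prod.smul_fst, Prod.smul_snd, Prod.fst_sum,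
    Prod.snd_sum, Finset.sum_sub_distrib, Finset.sum_add_distrib, hNY, hNZ, smul_eq_mul, mul_sub,
    mul_add, mul_inv_cancel_left₀ hn']
  exact ⟨by linarith, by linarith, by simp⟩

end Terms

variable {X₁ Y₁ Z₁ X₂ Y₂ Z₂ : Type*} [Fintype X₁] [Fintype Y₁] [Fintype Z₁] [Fintype X₂]
  [Fintype Y₂] [Fintype Z₂]

/-- The rate constraints, with the bound `c` on the common rate. -/
def Satisfies (q₁ : BroadcastChannel X₁ Y₁ Z₁) (q₂ : BroadcastChannel X₂ Y₂ Z₂)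
    (κ₁ : (X₁ → ℝ) × (ℝ × ℝ) × (ℝ × ℝ) × (ℝ × ℝ))
    (κ₂ : (X₂ → ℝ) × (ℝ × ℝ) × (ℝ × ℝ) × (ℝ × ℝ)) (R : ℝ × ℝ × ℝ) (c : ℝ) : Prop :=
  R.1 ≤ c ∧
  R.1 + R.2.1 ≤ c + ((κ₁.2.1.1 - κ₁.2.2.1.1) + (κ₂.2.1.1 - κ₂.2.2.1.1)) ∧
  R.1 + R.2.2 ≤ c + ((κ₁.2.1.2 - κ₁.2.2.2.2) + (κ₂.2.1.2 - κ₂.2.2.2.2)) ∧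
  R.1 + R.2.1 + R.2.2 ≤ c + (q₁.termUYXZ κ₁ + q₂.termUYXZ κ₂) ∧
  R.1 + R.2.1 + R.2.2 ≤ c + (q₁.termVZXY κ₁ + q₂.termVZXY κ₂) ∧
  R.1 + R.2.1 + R.2.2 ≤ c + (q₁.termVZXY κ₁ + q₂.termUYXZ κ₂)

/-- The triples that satisfy the rate constraints for given points of the entropy sets. -/
def IsBoundedBy (q₁ : BroadcastChannel X₁ Y₁ Z₁) (q₂ : BroadcastChannel X₂ Y₂ Z₂)
    (κ₁ : (X₁ → ℝ) × (ℝ × ℝ) × (ℝ × ℝ) × (ℝ × ℝ))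
    (κ₂ : (X₂ → ℝ) × (ℝ × ℝ) × (ℝ × ℝ) × (ℝ × ℝ)) (R : ℝ × ℝ × ℝ) : Prop :=
  Satisfies q₁ q₂ κ₁ κ₂ R (q₁.termWY κ₁ + q₂.termWY κ₂) ∧
    Satisfies q₁ q₂ κ₁ κ₂ R (q₁.termWZ κ₁ + q₂.termWZ κ₂)

/-- The outer bound in terms of the entropy sets. -/
def entropyOuterBound (q₁ : BroadcastChannel X₁ Y₁ Z₁) (q₂ : BroadcastChannel X₂ Y₂ Z₂) :
    Set (ℝ × ℝ × ℝ) :=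
  {R | ∃ κ₁ ∈ q₁.entropySet, ∃ κ₂ ∈ q₂.entropySet, IsBoundedBy q₁ q₂ κ₁ κ₂ R}

/-- Projection along a compact factor is a closed map, and the constraints are closed conditions in
all variables jointly. -/
theorem isClosed_entropyOuterBound (q₁ : BroadcastChannel X₁ Y₁ Z₁)
    (q₂ : BroadcastChannel X₂ Y₂ Z₂) : IsClosed (entropyOuterBound q₁ q₂) := by
  have := isCompact_iff_compactSpace.1 q₁.isCompact_entropySet
  have := isCompact_iff_compactSpace.1 q₂.isCompact_entropySet
  have h : entropyOuterBound q₁ q₂ = Prod.snd ''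
      {t : (q₁.entropySet × q₂.entropySet) × (ℝ × ℝ × ℝ) |
        IsBoundedBy q₁ q₂ t.1.1 t.1.2 t.2} := by
    ext R
    constructor
    · rintro ⟨κ₁, h₁, κ₂, h₂, h⟩
      exact ⟨((⟨κ₁, h₁⟩, ⟨κ₂, h₂⟩), R), h, rfl⟩
    · rintro ⟨⟨⟨κ₁, κ₂⟩, R⟩, h, rfl⟩
      exact ⟨κ₁, κ₁.2, κ₂, κ₂.2, h⟩
  rw [h]
  refine isClosedMap_snd_of_compactSpace _ ?_
  have c1 := continuous_outputEntropy q₁.margY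
  have c2 := continuous_outputEntropy q₁.margZ
  have c3 := continuous_outputEntropy q₂.margY
  have c4 := continuous_outputEntropy q₂.margZ
  have c5 := continuous_noiseEntropy q₁.margY
  have c6 := continuous_noiseEntropy q₁.margZ
  have c7 := continuous_noiseEntropy q₂.margY
  have c8 := continuous_noiseEntropy q₂.margZ
  unfold IsBoundedBy Satisfies termWY termWZ termUYXZ termVZXY
  simp only [Set.ofPred_and]
  repeat' refine IsClosed.inter ?_ ?_
  all_goals exact isClosed_le (by fun_prop) (by fun_prop)

theorem entropyOuterBound_subset (q₁ : BroadcastChannel X₁ Y₁ Z₁)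
    (q₂ : BroadcastChannel X₂ Y₂ Z₂) : entropyOuterBound q₁ q₂ ⊆ productOuterBound q₁ q₂ := by
  rintro R ⟨κ₁, h₁, κ₂, h₂, hY, hZ⟩
  obtain ⟨a₁, b₁, c₁, p₁, hp₁, e₁⟩ := q₁.exists_of_mem_entropySet h₁
  obtain ⟨a₂, b₂, c₂, p₂, hp₂, e₂⟩ := q₂.exists_of_mem_entropySet h₂
  refine ⟨a₁, b₁, c₁, a₂, b₂, c₂, p₁, hp₁, p₂, hp₂, ?_⟩
  simp only [Satisfies, termWY, termWZ, termUYXZ, termVZXY] at hY hZ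
  obtain ⟨hY1, hY2, hY3, hY4, hY5, hY6⟩ := hY
  obtain ⟨hZ1, hZ2, hZ3, hZ4, hZ5, hZ6⟩ := hZ
  obtain ⟨e11, e12, e13, e14, e15, e16⟩ := e₁
  obtain ⟨e21, e22, e23, e24, e25, e26⟩ := e₂
  simp only [regionOf, commonTerm, Set.mem_ofPred_eq, e11, e12, e13, e14, e15, e16, e21, e22, e23,
    e24, e25, e26]
  -- Each choice of branches in the minima is one of the inequalities in the two copies of
  -- `Satisfies`.
  refine ⟨le_min hY1 hZ1, ?_, ?_, ?_, ?_⟩ <;> simp only [min_def] <;> split_ifs <;> linarith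

end BroadcastChannel

/-! ### Single-letterization -/

section SingleLetter

variable {Ω S A B : Type*} [Fintype Ω] [Fintype S] [Fintype A] [Fintype B] {P : Ω → ℝ} {n : ℕ}
  {X Y Z : Type*} [Fintype X] [Fintype Y] [Fintype Z]

/-- Given side information that determines the inputs, the outputs carry the noise entropy. -/
theorem leftSum_eq_noiseEntropy {k : X → Y → ℝ} (hk : ∀ x, ∑ y, k x y = 1) (s : Ω → S)
    (x : Fin n → Ω → X) (y : Fin n → Ω → Y) (z : Fin n → Ω → Z) (φ : Fin n → S → X)
    (hφ : ∀ i ω, x i ω = φ i (s ω))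
    (h : ∀ i : Fin n, IsOutput P (pastFuture s y z i (i + 1)) (x i) (y i) k) :
    leftSum P s y z = ∑ i, noiseEntropy k (lawOf P (x i)) :=
  Finset.sum_congr rfl fun i _ =>
    (h i).entropyOf_sub_of_determines hk (fun t => φ i t.1) fun ω => hφ i ω

theorem rightSum_eq_noiseEntropy {k : X → Z → ℝ} (hk : ∀ x, ∑ z, k x z = 1) (s : Ω → S)
    (x : Fin n → Ω → X) (y : Fin n → Ω → Y) (z : Fin n → Ω → Z) (φ : Fin n → S → X)
    (hφ : ∀ i ω, x i ω = φ i (s ω))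
    (h : ∀ i : Fin n, IsOutput P (pastFuture s y z i (i + 1)) (x i) (z i) k) :
    rightSum P s y z = ∑ i, noiseEntropy k (lawOf P (x i)) :=
  Finset.sum_congr rfl fun i _ =>
    (h i).entropyOf_sub_of_determines hk (fun t => φ i t.1) fun ω => hφ i ω

/-- At time i, W consists of `w`, `s`, the `y` before i and the `z` after i, with U = `u` and V =
`v`; the times are then averaged. The conditional entropies are kept exactly, as left and right
sums, so that the Csiszár identity stays available. -/
theorem BroadcastChannel.exists_singleLetter {β γ δ : Type*} [Fintype β] [Fintype γ] [Fintype δ]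
    (q : BroadcastChannel X Y Z) (hP : ∀ ω, 0 ≤ P ω) (hP1 : ∑ ω, P ω = 1) (hn : 0 < n)
    (w : Ω → β) (u : Ω → γ) (v : Ω → δ) (s : Ω → S)
    (x : Fin n → Ω → X) (y : Fin n → Ω → Y) (z : Fin n → Ω → Z)
    (hY : ∀ i : Fin n, IsOutput P (pastFuture (fun ω => ((w ω, u ω, v ω), s ω)) y z i (i + 1))
      (x i) (y i) q.margY)
    (hZ : ∀ i : Fin n, IsOutput P (pastFuture (fun ω => ((w ω, u ω, v ω), s ω)) y z i (i + 1))
      (x i) (z i) q.margZ) :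
    ∃ κ ∈ q.entropySet,
      entropyOf P (fun ω i => y i ω) - leftSum P (fun ω => (w ω, s ω)) y z ≤ n * q.termWY κ ∧
      entropyOf P (fun ω i => z i ω) - rightSum P (fun ω => (w ω, s ω)) y z ≤ n * q.termWZ κ ∧
      leftSum P (fun ω => (w ω, s ω)) y z - leftSum P (fun ω => ((w ω, u ω), s ω)) y z
        = n * (κ.2.1.1 - κ.2.2.1.1) ∧
      rightSum P (fun ω => (w ω, s ω)) y z - rightSum P (fun ω => ((w ω, v ω), s ω)) y z
        = n * (κ.2.1.2 - κ.2.2.2.2) ∧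
      leftSum P (fun ω => (w ω, s ω)) y z - leftSum P (fun ω => ((w ω, u ω), s ω)) y z
        + (rightSum P (fun ω => ((w ω, u ω), s ω)) y z
          - ∑ i, noiseEntropy q.margZ (lawOf P (x i))) = n * q.termUYXZ κ ∧
      rightSum P (fun ω => (w ω, s ω)) y z - rightSum P (fun ω => ((w ω, v ω), s ω)) y z
        + (leftSum P (fun ω => ((w ω, v ω), s ω)) y z
          - ∑ i, noiseEntropy q.margY (lawOf P (x i))) = n * q.termVZXY κ := by
  have h1 := fun i : Fin n => (hY i).map (T := ((β × S) × ({l : Fin n // l.1 < i.1} → Y) ×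
    ({l : Fin n // i.1 + 1 ≤ l.1} → Z)) × γ × δ)
    fun t => (((t.1.1.1, t.1.2), t.2.1, t.2.2), t.1.1.2.1, t.1.1.2.2)
  have h2 := fun i : Fin n => (hZ i).map (T := ((β × S) × ({l : Fin n // l.1 < i.1} → Y) ×
    ({l : Fin n // i.1 + 1 ≤ l.1} → Z)) × γ × δ)
    fun t => (((t.1.1.1, t.1.2), t.2.1, t.2.2), t.1.1.2.1, t.1.1.2.2)
  obtain ⟨κ, hκ, a1, a2, a3, a4, a5, a6⟩ := q.exists_average hn fun i =>
    q.condEntropies_mem_entropySet hP hP1 (pastFuture (fun ω => (w ω, s ω)) y z i (i + 1)) u v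
      (pastFuture (fun ω => ((w ω, u ω), s ω)) y z i (i + 1))
      (pastFuture (fun ω => ((w ω, v ω), s ω)) y z i (i + 1)) (x i) (y i) (z i)
      (fun ω ω' => by simp only [pastFuture_eq_iff, Prod.mk.injEq]; tauto)
      (fun ω ω' => by simp only [pastFuture_eq_iff, Prod.mk.injEq]; tauto) (h1 i) (h2 i)
  refine ⟨κ, hκ, ?_⟩
  have eY : ∀ i, outputEntropy q.margY (lawOf P (x i)) = entropyOf P (y i) := fun i =>
    (((hY i).map fun _ => ()).entropyOf_eq hP1).symm
  have eZ : ∀ i, outputEntropy q.margZ (lawOf P (x i)) = entropyOf P (z i) := fun i =>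
    (((hZ i).map fun _ => ()).entropyOf_eq hP1).symm
  simp only [BroadcastChannel.termWY, BroadcastChannel.termWZ, BroadcastChannel.termUYXZ,
    BroadcastChannel.termVZXY, eY, eZ] at a1 a2 a5 a6
  have b1 := entropyOf_pi_le hP hP1 y
  have b2 := entropyOf_pi_le hP hP1 z
  unfold leftSum rightSum
  simp only [Finset.sum_sub_distrib, Finset.sum_add_distrib] at a1 a2 a3 a4 a5 a6 ⊢
  exact ⟨(sub_le_sub_right b1 _).trans a1, (sub_le_sub_right b2 _).trans a2, a3, a4, a5, a6⟩

end SingleLetter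

/-! ### The outer bound for blocks -/

section Blocks

variable {Ω S β γ δ Y₁ Z₁ Y₂ Z₂ X₁ X₂ : Type*} [Fintype Ω] [Fintype S] [Fintype β] [Fintype γ]
  [Fintype δ] [Fintype Y₁] [Fintype Z₁] [Fintype Y₂] [Fintype Z₂] [Fintype X₁] [Fintype X₂]
  {P : Ω → ℝ} {n : ℕ}

/-- The Csiszár sums of both components, for the side information `s`. -/
theorem csiszar_product (hP : ∀ ω, 0 ≤ P ω) (s : Ω → S) (y₁ : Fin n → Ω → Y₁) (z₁ : Fin n → Ω → Z₁)
    (y₂ : Fin n → Ω → Y₂) (z₂ : Fin n → Ω → Z₂) :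
    leftSum P (fun ω => (s ω, fun i => z₂ i ω)) y₁ z₁
        ≤ entropyOf P (fun ω => (s ω, (fun i => y₁ i ω), fun i => z₂ i ω))
          - entropyOf P (fun ω => (s ω, fun i => z₂ i ω)) ∧
      leftSum P (fun ω => (s ω, fun i => z₂ i ω)) y₁ z₁
          - rightSum P (fun ω => (s ω, fun i => z₂ i ω)) y₁ z₁
        = entropyOf P (fun ω => (s ω, (fun i => y₁ i ω), fun i => z₂ i ω))
          - entropyOf P (fun ω => (s ω, (fun i => z₁ i ω), fun i => z₂ i ω)) ∧
      leftSum P (fun ω => (s ω, fun i => y₁ i ω)) y₂ z₂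
        ≤ entropyOf P (fun ω => (s ω, (fun i => y₁ i ω), fun i => y₂ i ω))
          - entropyOf P (fun ω => (s ω, fun i => y₁ i ω)) ∧
      leftSum P (fun ω => (s ω, fun i => y₁ i ω)) y₂ z₂
          - rightSum P (fun ω => (s ω, fun i => y₁ i ω)) y₂ z₂
        = entropyOf P (fun ω => (s ω, (fun i => y₁ i ω), fun i => y₂ i ω))
          - entropyOf P (fun ω => (s ω, (fun i => y₁ i ω), fun i => z₂ i ω)) ∧
      entropyOf P (fun ω => (s ω, (fun i => y₁ i ω), fun i => z₂ i ω)) + entropyOf P s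
        ≤ entropyOf P (fun ω => (s ω, fun i => y₁ i ω))
          + entropyOf P (fun ω => (s ω, fun i => z₂ i ω)) := by
  have e1 : entropyOf P (fun ω => ((s ω, fun i => z₂ i ω), fun i => y₁ i ω))
      = entropyOf P (fun ω => (s ω, (fun i => y₁ i ω), fun i => z₂ i ω)) :=
    entropyOf_congr fun ω ω' => by simp only [Prod.mk.injEq]; tauto
  have e2 : entropyOf P (fun ω => ((s ω, fun i => z₂ i ω), fun i => z₁ i ω))
      = entropyOf P (fun ω => (s ω, (fun i => z₁ i ω), fun i => z₂ i ω)) :=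
    entropyOf_congr fun ω ω' => by simp only [Prod.mk.injEq]; tauto
  have e3 : entropyOf P (fun ω => ((s ω, fun i => y₁ i ω), fun i => y₂ i ω))
      = entropyOf P (fun ω => (s ω, (fun i => y₁ i ω), fun i => y₂ i ω)) :=
    entropyOf_congr fun ω ω' => by simp only [Prod.mk.injEq]; tauto
  have e4 : entropyOf P (fun ω => ((s ω, fun i => y₁ i ω), fun i => z₂ i ω))
      = entropyOf P (fun ω => (s ω, (fun i => y₁ i ω), fun i => z₂ i ω)) :=
    entropyOf_congr fun ω ω' => by simp only [Prod.mk.injEq]; tauto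
  refine ⟨?_, ?_, ?_, ?_, ?_⟩
  · rw [← e1]; exact leftSum_le hP _ _ _
  · rw [← e1, ← e2]; exact leftSum_sub_rightSum _ _ _
  · rw [← e3]; exact leftSum_le hP _ _ _
  · rw [← e3, ← e4]; exact leftSum_sub_rightSum _ _ _
  · exact entropyOf_submodular hP _ _ _ _ (fun ω ω' => by simp only [Prod.mk.injEq]; tauto)
      (fun ω ω' => by simp only [Prod.mk.injEq]; tauto)
      (fun ω ω' => by simp only [Prod.mk.injEq]; tauto)

/-- With `s` an output, this lets the information of one private message survive conditioning on the
other. -/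
theorem entropyOf_four_point (hP : ∀ ω, 0 ≤ P ω) (w : Ω → β) (u : Ω → γ) (v : Ω → δ) (s : Ω → S) :
    entropyOf P (fun ω => ((w ω, u ω, v ω), s ω)) + entropyOf P (fun ω => (w ω, s ω))
      ≤ entropyOf P (fun ω => ((w ω, u ω), s ω)) + entropyOf P (fun ω => ((w ω, v ω), s ω)) :=
  entropyOf_submodular hP _ _ _ _ (fun ω ω' => by simp only [Prod.mk.injEq]; tauto)
    (fun ω ω' => by simp only [Prod.mk.injEq]; tauto)
    (fun ω ω' => by simp only [Prod.mk.injEq]; tauto)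

open BroadcastChannel in
theorem exists_isBoundedBy (q₁ : BroadcastChannel X₁ Y₁ Z₁) (q₂ : BroadcastChannel X₂ Y₂ Z₂)
    (hP : ∀ ω, 0 ≤ P ω) (hP1 : ∑ ω, P ω = 1) (hn : 0 < n) (w : Ω → β) (u : Ω → γ) (v : Ω → δ)
    (x₁ : Fin n → Ω → X₁) (y₁ : Fin n → Ω → Y₁) (z₁ : Fin n → Ω → Z₁)
    (x₂ : Fin n → Ω → X₂) (y₂ : Fin n → Ω → Y₂) (z₂ : Fin n → Ω → Z₂)
    (φ₁ : Fin n → β × γ × δ → X₁) (hφ₁ : ∀ i ω, x₁ i ω = φ₁ i (w ω, u ω, v ω))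
    (φ₂ : Fin n → β × γ × δ → X₂) (hφ₂ : ∀ i ω, x₂ i ω = φ₂ i (w ω, u ω, v ω))
    (hY₁ : ∀ i : Fin n, IsOutput P (pastFuture (fun ω => ((w ω, u ω, v ω), fun i => z₂ i ω))
      y₁ z₁ i (i + 1)) (x₁ i) (y₁ i) q₁.margY)
    (hZ₁ : ∀ i : Fin n, IsOutput P (pastFuture (fun ω => ((w ω, u ω, v ω), fun i => z₂ i ω))
      y₁ z₁ i (i + 1)) (x₁ i) (z₁ i) q₁.margZ)
    (hY₂ : ∀ i : Fin n, IsOutput P (pastFuture (fun ω => ((w ω, u ω, v ω), fun i => y₁ i ω))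
      y₂ z₂ i (i + 1)) (x₂ i) (y₂ i) q₂.margY)
    (hZ₂ : ∀ i : Fin n, IsOutput P (pastFuture (fun ω => ((w ω, u ω, v ω), fun i => y₁ i ω))
      y₂ z₂ i (i + 1)) (x₂ i) (z₂ i) q₂.margZ)
    {L₀ L₁ L₂ ε : ℝ} (hε : 0 ≤ ε) (hw : entropyOf P w = L₀)
    (hwu : entropyOf P (fun ω => (w ω, u ω)) = L₀ + L₁)
    (hwv : entropyOf P (fun ω => (w ω, v ω)) = L₀ + L₂)
    (hwuv : entropyOf P (fun ω => (w ω, u ω, v ω)) = L₀ + L₁ + L₂)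
    (fanoY : entropyOf P (fun ω => ((w ω, u ω), (fun i => y₁ i ω), fun i => y₂ i ω))
      - entropyOf P (fun ω => ((fun i => y₁ i ω), fun i => y₂ i ω)) ≤ ε)
    (fanoZ : entropyOf P (fun ω => ((w ω, v ω), (fun i => z₁ i ω), fun i => z₂ i ω))
      - entropyOf P (fun ω => ((fun i => z₁ i ω), fun i => z₂ i ω)) ≤ ε) :
    ∃ κ₁ ∈ q₁.entropySet, ∃ κ₂ ∈ q₂.entropySet,
      IsBoundedBy q₁ q₂ κ₁ κ₂ ((L₀ - 3 * ε) / n, (L₁ - 3 * ε) / n, (L₂ - 3 * ε) / n) := by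
  obtain ⟨κ₁, hκ₁, a1, a2, a3, a4, a5, a6⟩ := q₁.exists_singleLetter hP hP1 hn w u v
    (fun ω i => z₂ i ω) x₁ y₁ z₁ hY₁ hZ₁
  obtain ⟨κ₂, hκ₂, b1, b2, b3, b4, b5, b6⟩ := q₂.exists_singleLetter hP hP1 hn w u v
    (fun ω i => y₁ i ω) x₂ y₂ z₂ hY₂ hZ₂
  refine ⟨κ₁, hκ₁, κ₂, hκ₂, ?_⟩
  -- The messages determine the inputs, so each noise entropy is itself a left or right sum with
  -- side information (w, u, v), to which `csiszar_product` applies too.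
  have n1 := leftSum_eq_noiseEntropy q₁.sum_margY _ x₁ y₁ z₁ (fun i t => φ₁ i t.1) hφ₁ hY₁
  have n2 := rightSum_eq_noiseEntropy q₁.sum_margZ _ x₁ y₁ z₁ (fun i t => φ₁ i t.1) hφ₁ hZ₁
  have n3 := leftSum_eq_noiseEntropy q₂.sum_margY _ x₂ y₂ z₂ (fun i t => φ₂ i t.1) hφ₂ hY₂
  have n4 := rightSum_eq_noiseEntropy q₂.sum_margZ _ x₂ y₂ z₂ (fun i t => φ₂ i t.1) hφ₂ hZ₂
  rw [← n1] at a6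
  rw [← n2] at a5
  rw [← n3] at b6
  rw [← n4] at b5
  obtain ⟨w1, w2, w3, w4, w5⟩ := csiszar_product hP w y₁ z₁ y₂ z₂
  obtain ⟨u1, u2, u3, u4, u5⟩ := csiszar_product hP (fun ω => (w ω, u ω)) y₁ z₁ y₂ z₂
  obtain ⟨v1, v2, v3, v4, v5⟩ := csiszar_product hP (fun ω => (w ω, v ω)) y₁ z₁ y₂ z₂
  obtain ⟨m1, m2, m3, m4, m5⟩ := csiszar_product hP (fun ω => (w ω, u ω, v ω)) y₁ z₁ y₂ z₂
  have fY := entropyOf_four_point hP w u v fun ω => ((fun i => y₁ i ω), fun i => y₂ i ω)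
  have fZ := entropyOf_four_point hP w u v fun ω => ((fun i => z₁ i ω), fun i => z₂ i ω)
  -- The hybrid output (Y₁, Z₂), for the mixed sum-rate constraint.
  have fC := entropyOf_four_point hP w u v fun ω => ((fun i => y₁ i ω), fun i => z₂ i ω)
  have mY : entropyOf P (fun ω => ((fun i => y₁ i ω), fun i => y₂ i ω))
      ≤ entropyOf P (fun ω => (w ω, (fun i => y₁ i ω), fun i => y₂ i ω)) :=
    entropyOf_mono hP fun ω ω' => by simp only [Prod.mk.injEq]; tauto
  have mZ : entropyOf P (fun ω => ((fun i => z₁ i ω), fun i => z₂ i ω))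
      ≤ entropyOf P (fun ω => (w ω, (fun i => z₁ i ω), fun i => z₂ i ω)) :=
    entropyOf_mono hP fun ω ω' => by simp only [Prod.mk.injEq]; tauto
  have mY' : entropyOf P (fun ω => (w ω, (fun i => y₁ i ω), fun i => y₂ i ω))
      ≤ entropyOf P (fun ω => ((w ω, u ω), (fun i => y₁ i ω), fun i => y₂ i ω)) :=
    entropyOf_mono hP fun ω ω' => by simp only [Prod.mk.injEq]; tauto
  have mZ' : entropyOf P (fun ω => (w ω, (fun i => z₁ i ω), fun i => z₂ i ω))
      ≤ entropyOf P (fun ω => ((w ω, v ω), (fun i => z₁ i ω), fun i => z₂ i ω)) :=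
    entropyOf_mono hP fun ω ω' => by simp only [Prod.mk.injEq]; tauto
  have sY := entropyOf_prodMk_le hP hP1 (fun ω i => y₁ i ω) (fun ω i => y₂ i ω)
  have sZ := entropyOf_prodMk_le hP hP1 (fun ω i => z₁ i ω) (fun ω i => z₂ i ω)
  rw [hw] at w5
  rw [hwu] at u5
  rw [hwv] at v5
  rw [hwuv] at m5
  have hn' : (0 : ℝ) < n := by exact_mod_cast hn
  -- For each message group s, adding the facts from `csiszar_product` bounds the two left sums by
  -- H(s, Y) - H(s) and the two right sums by H(s, Z) - H(s). All twelve bounds are then linear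
  -- consequences; the Fano losses are absorbed by the `3 * ε` taken off each rate.
  refine ⟨⟨?_, ?_, ?_, ?_, ?_, ?_⟩, ⟨?_, ?_, ?_, ?_, ?_, ?_⟩⟩ <;>
    simp only [← add_div] <;> rw [div_le_iff₀' hn'] <;> simp only [mul_add] <;>
    linarith

end Blocks

/-! ### Codes -/

section Codes

theorem lawOf_eq {Ω A : Type*} [Fintype Ω] [DecidableEq A] (P : Ω → ℝ) (f : Ω → A) (a : A) :
    lawOf P f a = ∑ ω, if f ω = a then P ω else 0 := by
  unfold lawOf
  refine Finset.sum_congr rfl fun ω _ => ?_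
  split_ifs <;> rfl

theorem sum_prod_pi {n : ℕ} {O : Type*} [Fintype O] {f : Fin n → O → ℝ}
    (hf : ∀ i, ∑ o, f i o = 1) : ∑ o : Fin n → O, ∏ i, f i (o i) = 1 := by
  classical
  rw [← Fintype.piFinset_univ, ← Finset.prod_univ_sum]
  simp [hf]

/-- A coordinate of the output of a memoryless channel. -/
theorem isOutput_of_memoryless {Ω R S X Y O : Type*} [Fintype Ω] [Fintype R] [Fintype O]
    {P : Ω → ℝ} {n : ℕ} (i : Fin n) (e : Ω ≃ R × (Fin n → O)) (Q : R → ℝ) (ξ : Fin n → R → X)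
    (κ : X → O → ℝ) (hκ : ∀ x, ∑ o, κ x o = 1) (η : O → Y) {f : Ω → S} {g : Ω → X} {h : Ω → Y}
    (hP : ∀ r o, P (e.symm (r, o)) = Q r * ∏ j, κ (ξ j r) (o j))
    (hf : ∀ r o o', (∀ j, j ≠ i → o j = o' j) → f (e.symm (r, o)) = f (e.symm (r, o')))
    (hg : ∀ r o, g (e.symm (r, o)) = ξ i r) (hh : ∀ r o, h (e.symm (r, o)) = η (o i)) :
    IsOutput P f g h fun x => lawOf (κ x) η := by
  classical
  -- The noise of the other coordinates is moved into the data, leaving coordinate `i` as the only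
  -- fresh noise.
  let s : R × (Fin n → O) ≃ (R × ({j // j ≠ i} → O)) × O :=
    { toFun := fun t => ((t.1, (Equiv.funSplitAt i O t.2).2), (Equiv.funSplitAt i O t.2).1)
      invFun := fun t => (t.1.1, (Equiv.funSplitAt i O).symm (t.2, t.1.2))
      left_inv := fun t => Prod.ext rfl ((Equiv.funSplitAt i O).symm_apply_apply t.2)
      right_inv := fun t => by simp }
  have hs : ∀ (r : R) (a : {j // j ≠ i} → O) (o : O), (e.trans s).symm ((r, a), o)
      = e.symm (r, (Equiv.funSplitAt i O).symm (o, a)) := fun _ _ _ => rfl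
  have hi : ∀ (a : {j // j ≠ i} → O) (o : O), (Equiv.funSplitAt i O).symm (o, a) i = o := by
    intro a o; simp [Equiv.funSplitAt, Equiv.piSplitAt]
  have hne : ∀ (a : {j // j ≠ i} → O) (o : O) (j : {j // j ≠ i}),
      (Equiv.funSplitAt i O).symm (o, a) j = a j := by
    intro a o j; simp [Equiv.funSplitAt, Equiv.piSplitAt, j.2]
  refine isOutput_of_equiv (e.trans s) (fun t => Q t.1 * ∏ j : {j // j ≠ i}, κ (ξ j t.1) (t.2 j))
    (fun t => ξ i t.1) κ hκ η ?_ ?_ ?_ ?_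
  · rintro ⟨r, a⟩ o
    rw [hs, hP, Fintype.prod_eq_mul_prod_subtype_ne _ i, hi]
    simp only [hne]
    ring
  · rintro ⟨r, a⟩ o o'
    rw [hs, hs]
    exact hf r _ _ fun j hj => (hne a o ⟨j, hj⟩).trans (hne a o' ⟨j, hj⟩).symm
  · rintro ⟨r, a⟩ o
    rw [hs, hg]
  · rintro ⟨r, a⟩ o
    rw [hs, hh, hi]

variable {X₁ Y₁ Z₁ X₂ Y₂ Z₂ : Type*} [Fintype Y₁] [Fintype Z₁]
  [Fintype Y₂] [Fintype Z₂] {n K₀ K₁ K₂ : ℕ}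

/-- The messages and the outputs of both components. -/
abbrev CodeSpace (Y₁ Z₁ Y₂ Z₂ : Type*) (n K₀ K₁ K₂ : ℕ) : Type _ :=
  (Fin K₀ × Fin K₁ × Fin K₂) × (Fin n → Y₁ × Z₁) × (Fin n → Y₂ × Z₂)

namespace BroadcastCode

variable (q₁ : BroadcastChannel X₁ Y₁ Z₁) (q₂ : BroadcastChannel X₂ Y₂ Z₂)
  (c : BroadcastCode (X₁ × X₂) (Y₁ × Y₂) (Z₁ × Z₂) n K₀ K₁ K₂)

/-- The input letters as a function of the messages. -/
def input (i : Fin n) (m : Fin K₀ × Fin K₁ × Fin K₂) : X₁ × X₂ := c.enc m.1 m.2.1 m.2.2 i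

/-- The joint law of the messages and the outputs. -/
noncomputable def law (ω : CodeSpace Y₁ Z₁ Y₂ Z₂ n K₀ K₁ K₂) : ℝ :=
  ((K₀ : ℝ) * K₁ * K₂)⁻¹ * ((∏ i, (q₁ (c.input i ω.1).1).1 (ω.2.1 i))
    * ∏ i, (q₂ (c.input i ω.1).2).1 (ω.2.2 i))

theorem law_nonneg (ω : CodeSpace Y₁ Z₁ Y₂ Z₂ n K₀ K₁ K₂) : 0 ≤ c.law q₁ q₂ ω :=
  mul_nonneg (by positivity) (mul_nonneg (Finset.prod_nonneg fun _ _ => (q₁ _).2.1 _)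
    (Finset.prod_nonneg fun _ _ => (q₂ _).2.1 _))

theorem lawOf_message {A : Type*} (f : Fin K₀ × Fin K₁ × Fin K₂ → A) (a : A) :
    lawOf (c.law q₁ q₂) (fun ω => f ω.1) a
      = lawOf (fun _ => ((K₀ : ℝ) * K₁ * K₂)⁻¹) f a := by
  unfold lawOf
  rw [Fintype.sum_prod_type]
  refine Finset.sum_congr rfl fun m _ => ?_
  by_cases h : f m = a
  · simp only [h, if_true, law, ← Finset.mul_sum]
    rw [Fintype.sum_prod_type]
    dsimp only
    rw [← Finset.sum_mul_sum, sum_prod_pi fun i => (q₁ _).2.2,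
      sum_prod_pi fun i => (q₂ _).2.2, mul_one, mul_one]
  · simp [h]

theorem sum_law (h₀ : 0 < K₀) (h₁ : 0 < K₁) (h₂ : 0 < K₂) : ∑ ω, c.law q₁ q₂ ω = 1 := by
  have := c.lawOf_message q₁ q₂ (fun _ => ()) ()
  simp only [lawOf, if_true] at this
  rw [this]
  simp
  field_simp

theorem entropyOf_message (h₀ : 0 < K₀) (h₁ : 0 < K₁) (h₂ : 0 < K₂) :
    entropyOf (c.law q₁ q₂) (fun ω => ω.1.1) = Real.logb 2 K₀ ∧
    entropyOf (c.law q₁ q₂) (fun ω => (ω.1.1, ω.1.2.1)) = Real.logb 2 K₀ + Real.logb 2 K₁ ∧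
    entropyOf (c.law q₁ q₂) (fun ω => (ω.1.1, ω.1.2.2)) = Real.logb 2 K₀ + Real.logb 2 K₂ ∧
    entropyOf (c.law q₁ q₂) (fun ω => (ω.1.1, ω.1.2.1, ω.1.2.2))
      = Real.logb 2 K₀ + Real.logb 2 K₁ + Real.logb 2 K₂ := by
  have h₀' : (K₀ : ℝ) ≠ 0 := by positivity
  have h₁' : (K₁ : ℝ) ≠ 0 := by positivity
  have h₂' : (K₂ : ℝ) ≠ 0 := by positivity
  have full : ∀ a b d, lawOf (c.law q₁ q₂) (fun ω => (ω.1.1, ω.1.2.1, ω.1.2.2)) (a, b, d)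
      = ((K₀ : ℝ) * K₁ * K₂)⁻¹ := by
    intro a b d
    rw [c.lawOf_message q₁ q₂ fun m => (m.1, m.2.1, m.2.2)]
    simp [lawOf_eq]
  have h01 : ∀ a b, lawOf (c.law q₁ q₂) (fun ω => (ω.1.1, ω.1.2.1)) (a, b)
      = ((K₀ : ℝ) * K₁)⁻¹ := by
    intro a b
    rw [← sum_lawOf_prodMk _ _ (fun ω => ω.1.2.2)]
    refine (Finset.sum_congr rfl fun d _ => (lawOf_congr (b := (a, b, d)) fun ω => ?_).trans
      (full a b d)).trans ?_
    · simp only [Prod.mk.injEq, and_assoc]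
    · simp
      field_simp
  have h02 : ∀ a d, lawOf (c.law q₁ q₂) (fun ω => (ω.1.1, ω.1.2.2)) (a, d)
      = ((K₀ : ℝ) * K₂)⁻¹ := by
    intro a d
    rw [← sum_lawOf_prodMk _ _ (fun ω => ω.1.2.1)]
    refine (Finset.sum_congr rfl fun b _ => (lawOf_congr (b := (a, b, d)) fun ω => ?_).trans
      (full a b d)).trans ?_
    · simp only [Prod.mk.injEq]; tauto
    · simp
      field_simp
  have h0 : ∀ a, lawOf (c.law q₁ q₂) (fun ω => ω.1.1) a = (K₀ : ℝ)⁻¹ := by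
    intro a
    rw [← sum_lawOf_prodMk _ _ (fun ω => ω.1.2.1)]
    simp only [h01]
    simp
    field_simp
  refine ⟨?_, ?_, ?_, ?_⟩
  · rw [entropyOf_uniform _ (by simpa using h0) (by simpa)]
    simp
  · rw [entropyOf_uniform _ (by rintro ⟨a, b⟩; simp [h01]) (by simp [h₀, h₁])]
    simp [Real.logb_mul h₀' h₁']
  · rw [entropyOf_uniform _ (by rintro ⟨a, b⟩; simp [h02]) (by simp [h₀, h₂])]
    simp [Real.logb_mul h₀' h₂']
  · rw [entropyOf_uniform _ (by rintro ⟨a, b, d⟩; rw [full]; simp; ring) (by simp [h₀, h₁, h₂])]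
    simp [Real.logb_mul h₀' (mul_ne_zero h₁' h₂'), Real.logb_mul h₁' h₂', add_assoc]

/-- The outputs of both receivers, sorted by components. -/
def sortOutputs (Y₁ Z₁ Y₂ Z₂ : Type*) (n : ℕ) :
    (Fin n → Y₁ × Y₂) × (Fin n → Z₁ × Z₂) ≃ (Fin n → Y₁ × Z₁) × (Fin n → Y₂ × Z₂) where
  toFun t := (fun i => ((t.1 i).1, (t.2 i).1), fun i => ((t.1 i).2, (t.2 i).2))
  invFun t := (fun i => ((t.1 i).1, (t.2 i).1), fun i => ((t.1 i).2, (t.2 i).2))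
  left_inv _ := rfl
  right_inv _ := rfl

open Classical in
theorem errY_eq : c.errY (q₁.prod q₂) = ∑ ω : CodeSpace Y₁ Z₁ Y₂ Z₂ n K₀ K₁ K₂,
    if c.decY (fun i => ((ω.2.1 i).1, (ω.2.2 i).1)) ≠ (ω.1.1, ω.1.2.1)
      then c.law q₁ q₂ ω else 0 := by
  rw [Fintype.sum_prod_type]
  simp only [← (sortOutputs Y₁ Z₁ Y₂ Z₂ n).sum_comp]
  simp only [Fintype.sum_prod_type, errY, Finset.sum_div, sortOutputs, Equiv.coe_fn_mk,
    BroadcastChannel.prod, law, input, Finset.prod_mul_distrib]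
  refine Finset.sum_congr rfl fun _ _ => Finset.sum_congr rfl fun _ _ =>
    Finset.sum_congr rfl fun _ _ => Finset.sum_congr rfl fun _ _ =>
    Finset.sum_congr rfl fun _ _ => ?_
  split_ifs
  · rw [div_eq_inv_mul]
  · simp

open Classical in
theorem errZ_eq : c.errZ (q₁.prod q₂) = ∑ ω : CodeSpace Y₁ Z₁ Y₂ Z₂ n K₀ K₁ K₂,
    if c.decZ (fun i => ((ω.2.1 i).2, (ω.2.2 i).2)) ≠ (ω.1.1, ω.1.2.2)
      then c.law q₁ q₂ ω else 0 := by
  rw [Fintype.sum_prod_type]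
  simp only [← (sortOutputs Y₁ Z₁ Y₂ Z₂ n).sum_comp]
  simp only [Fintype.sum_prod_type, errZ, Finset.sum_div, sortOutputs, Equiv.coe_fn_mk,
    BroadcastChannel.prod, law, input, Finset.prod_mul_distrib]
  refine Finset.sum_congr rfl fun _ _ => Finset.sum_congr rfl fun _ _ =>
    Finset.sum_congr rfl fun _ _ => Finset.sum_congr rfl fun _ _ =>
    Finset.sum_congr rfl fun _ _ => ?_
  split_ifs
  · rw [div_eq_inv_mul]
  · simp

theorem errY_nonneg : 0 ≤ c.errY (q₁.prod q₂) := by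
  classical
  rw [errY_eq]
  exact Finset.sum_nonneg fun ω _ => by split_ifs; exacts [c.law_nonneg q₁ q₂ ω, le_rfl]

theorem errZ_nonneg : 0 ≤ c.errZ (q₁.prod q₂) := by
  classical
  rw [errZ_eq]
  exact Finset.sum_nonneg fun ω _ => by split_ifs; exacts [c.law_nonneg q₁ q₂ ω, le_rfl]

/-- The first component of the outputs, at the end. -/
def splitFirst (Y₁ Z₁ Y₂ Z₂ : Type*) (n K₀ K₁ K₂ : ℕ) : CodeSpace Y₁ Z₁ Y₂ Z₂ n K₀ K₁ K₂ ≃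
    ((Fin K₀ × Fin K₁ × Fin K₂) × (Fin n → Y₂ × Z₂)) × (Fin n → Y₁ × Z₁) where
  toFun ω := ((ω.1, ω.2.2), ω.2.1)
  invFun t := (t.1.1, t.2, t.1.2)
  left_inv _ := rfl
  right_inv _ := rfl

/-- The second component of the outputs, at the end. -/
def splitSecond (Y₁ Z₁ Y₂ Z₂ : Type*) (n K₀ K₁ K₂ : ℕ) : CodeSpace Y₁ Z₁ Y₂ Z₂ n K₀ K₁ K₂ ≃
    ((Fin K₀ × Fin K₁ × Fin K₂) × (Fin n → Y₁ × Z₁)) × (Fin n → Y₂ × Z₂) where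
  toFun ω := ((ω.1, ω.2.1), ω.2.2)
  invFun t := (t.1.1, t.1.2, t.2)
  left_inv _ := rfl
  right_inv _ := rfl

/-- The data `f` may contain the messages, all outputs of the second component and every other
coordinate of the first. This admits the crossed side information Z₂ⁿ. -/
theorem isOutput_first {S Y : Type*} (i : Fin n) (η : Y₁ × Z₁ → Y)
    (f : CodeSpace Y₁ Z₁ Y₂ Z₂ n K₀ K₁ K₂ → S)
    (hf : ∀ m o o' r, (∀ j, j ≠ i → o j = o' j) → f (m, o, r) = f (m, o', r)) :
    IsOutput (c.law q₁ q₂) f (fun ω => (c.input i ω.1).1) (fun ω => η (ω.2.1 i))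
      fun x => lawOf (q₁ x).1 η :=
  isOutput_of_memoryless i (splitFirst Y₁ Z₁ Y₂ Z₂ n K₀ K₁ K₂)
    (fun r => ((K₀ : ℝ) * K₁ * K₂)⁻¹ * ∏ i, (q₂ (c.input i r.1).2).1 (r.2 i))
    (fun i r => (c.input i r.1).1) (fun x => (q₁ x).1) (fun x => (q₁ x).2.2) η
    (fun r o => by simp only [splitFirst, law, Equiv.coe_fn_symm_mk]; ring)
    (fun r o o' h => hf r.1 o o' r.2 h) (fun _ _ => rfl) (fun _ _ => rfl)

theorem isOutput_second {S Y : Type*} (i : Fin n) (η : Y₂ × Z₂ → Y)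
    (f : CodeSpace Y₁ Z₁ Y₂ Z₂ n K₀ K₁ K₂ → S)
    (hf : ∀ m o o' r, (∀ j, j ≠ i → o j = o' j) → f (m, r, o) = f (m, r, o')) :
    IsOutput (c.law q₁ q₂) f (fun ω => (c.input i ω.1).2) (fun ω => η (ω.2.2 i))
      fun x => lawOf (q₂ x).1 η :=
  isOutput_of_memoryless i (splitSecond Y₁ Z₁ Y₂ Z₂ n K₀ K₁ K₂)
    (fun r => ((K₀ : ℝ) * K₁ * K₂)⁻¹ * ∏ i, (q₁ (c.input i r.1).1).1 (r.2 i))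
    (fun i r => (c.input i r.1).2) (fun x => (q₂ x).1) (fun x => (q₂ x).2.2) η
    (fun r o => by simp only [splitSecond, law, Equiv.coe_fn_symm_mk]; ring)
    (fun r o o' h => hf r.1 o o' r.2 h) (fun _ _ => rfl) (fun _ _ => rfl)

theorem exists_isBoundedBy [Fintype X₁] [Fintype X₂] (hn : 0 < n) (h₀ : 0 < K₀) (h₁ : 0 < K₁) (h₂ : 0 < K₂) {ε : ℝ}
    (hY : 1 + c.errY (q₁.prod q₂) * (Real.logb 2 K₀ + Real.logb 2 K₁) ≤ ε)
    (hZ : 1 + c.errZ (q₁.prod q₂) * (Real.logb 2 K₀ + Real.logb 2 K₂) ≤ ε) :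
    ∃ κ₁ ∈ q₁.entropySet, ∃ κ₂ ∈ q₂.entropySet,
      BroadcastChannel.IsBoundedBy q₁ q₂ κ₁ κ₂ ((Real.logb 2 K₀ - 3 * ε) / n,
        (Real.logb 2 K₁ - 3 * ε) / n, (Real.logb 2 K₂ - 3 * ε) / n) := by
  have hP := c.law_nonneg q₁ q₂
  have hP1 := c.sum_law q₁ q₂ h₀ h₁ h₂
  obtain ⟨e1, e2, e3, e4⟩ := c.entropyOf_message q₁ q₂ h₀ h₁ h₂
  have h₀' : (K₀ : ℝ) ≠ 0 := by positivity
  have h₁' : (K₁ : ℝ) ≠ 0 := by positivity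
  have h₂' : (K₂ : ℝ) ≠ 0 := by positivity
  have hL : ∀ K : ℕ, 0 ≤ Real.logb 2 K := fun K => by
    rcases K.eq_zero_or_pos with rfl | h
    · simp
    · exact Real.logb_nonneg one_lt_two (by exact_mod_cast h)
  have fY := fano hP hP1 (fun ω => (ω.1.1, ω.1.2.1))
    (fun ω => ((fun i => (ω.2.1 i).1), fun i => (ω.2.2 i).1))
    fun t => c.decY fun i => (t.1 i, t.2 i)
  have fZ := fano hP hP1 (fun ω => (ω.1.1, ω.1.2.2))
    (fun ω => ((fun i => (ω.2.1 i).2), fun i => (ω.2.2 i).2))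
    fun t => c.decZ fun i => (t.1 i, t.2 i)
  rw [show (∑ ω : CodeSpace Y₁ Z₁ Y₂ Z₂ n K₀ K₁ K₂, _) = c.errY (q₁.prod q₂) from
    (Finset.sum_congr rfl fun ω _ => by congr).trans (c.errY_eq q₁ q₂).symm, Fintype.card_prod, Fintype.card_fin, Fintype.card_fin, Nat.cast_mul,
    Real.logb_mul h₀' h₁'] at fY
  rw [show (∑ ω : CodeSpace Y₁ Z₁ Y₂ Z₂ n K₀ K₁ K₂, _) = c.errZ (q₁.prod q₂) from
    (Finset.sum_congr rfl fun ω _ => by congr).trans (c.errZ_eq q₁ q₂).symm, Fintype.card_prod, Fintype.card_fin, Fintype.card_fin, Nat.cast_mul,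
    Real.logb_mul h₀' h₂'] at fZ
  refine _root_.exists_isBoundedBy (P := c.law q₁ q₂) q₁ q₂ hP hP1 hn (fun ω => ω.1.1)
    (fun ω => ω.1.2.1) (fun ω => ω.1.2.2)
    (fun i ω => (c.input i ω.1).1) (fun i ω => (ω.2.1 i).1) (fun i ω => (ω.2.1 i).2)
    (fun i ω => (c.input i ω.1).2) (fun i ω => (ω.2.2 i).1) (fun i ω => (ω.2.2 i).2)
    (fun i m => (c.input i m).1) (fun _ _ => rfl) (fun i m => (c.input i m).2) (fun _ _ => rfl)
    (fun i => c.isOutput_first q₁ q₂ i Prod.fst _ ?_)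
    (fun i => c.isOutput_first q₁ q₂ i Prod.snd _ ?_)
    (fun i => c.isOutput_second q₁ q₂ i Prod.fst _ ?_)
    (fun i => c.isOutput_second q₁ q₂ i Prod.snd _ ?_)
    ?_ e1 e2 e3 e4 (fY.trans hY) (fZ.trans hZ)
  rotate_right
  · have := mul_nonneg (c.errY_nonneg q₁ q₂) (add_nonneg (hL K₀) (hL K₁))
    linarith
  -- The past stops before `i` and the future starts at i + 1, so coordinate `i` never enters the
  -- conditioning.
  all_goals
    intro m o o' r h
    rw [pastFuture_eq_iff]
    refine ⟨rfl, fun l hl => ?_, fun l hl => ?_⟩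
    · simp only [h l (by rintro rfl; omega)]
    · simp only [h l (by rintro rfl; omega)]

end BroadcastCode

end Codes

/-! ### The outer bound -/

section OuterBound

theorem logb_numMessages_le {n : ℕ} {R : ℝ} (hR : 0 ≤ R) :
    0 < numMessages n R ∧ Real.logb 2 (numMessages n R) ≤ n * R ∧
      n * R - 1 ≤ Real.logb 2 (numMessages n R) := by
  have h1 : (1 : ℝ) ≤ 2 ^ ((n : ℝ) * R) := Real.one_le_rpow one_le_two (by positivity)
  have h2 : 0 < numMessages n R := Nat.floor_pos.2 h1
  have h3 : (0 : ℝ) < numMessages n R := by exact_mod_cast h2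
  refine ⟨h2, ?_, ?_⟩
  · rw [Real.logb_le_iff_le_rpow one_lt_two h3]
    exact Nat.floor_le (by positivity)
  -- Rounding down a number that is at least one loses at most a factor of two, that is, one bit.
  · rw [Real.le_logb_iff_rpow_le one_lt_two h3, Real.rpow_sub_one two_ne_zero]
    have h4 : (2 : ℝ) ^ ((n : ℝ) * R) < numMessages n R + 1 := Nat.lt_floor_add_one _
    have h5 : (1 : ℝ) ≤ numMessages n R := by exact_mod_cast h2
    linarith

variable {X₁ Y₁ Z₁ X₂ Y₂ Z₂ : Type*} [Fintype X₁] [Fintype Y₁] [Fintype Z₁] [Fintype X₂]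
  [Fintype Y₂] [Fintype Z₂]

theorem BroadcastChannel.IsBoundedBy.mono {q₁ : BroadcastChannel X₁ Y₁ Z₁}
    {q₂ : BroadcastChannel X₂ Y₂ Z₂} {κ₁ : (X₁ → ℝ) × (ℝ × ℝ) × (ℝ × ℝ) × (ℝ × ℝ)}
    {κ₂ : (X₂ → ℝ) × (ℝ × ℝ) × (ℝ × ℝ) × (ℝ × ℝ)} {R R' : ℝ × ℝ × ℝ}
    (h : IsBoundedBy q₁ q₂ κ₁ κ₂ R) (hR : R' ≤ R) : IsBoundedBy q₁ q₂ κ₁ κ₂ R' := by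
  obtain ⟨r1, r2, r3⟩ : R'.1 ≤ R.1 ∧ R'.2.1 ≤ R.2.1 ∧ R'.2.2 ≤ R.2.2 := ⟨hR.1, hR.2.1, hR.2.2⟩
  obtain ⟨⟨a1, a2, a3, a4, a5, a6⟩, ⟨b1, b2, b3, b4, b5, b6⟩⟩ := h
  refine ⟨⟨?_, ?_, ?_, ?_, ?_, ?_⟩, ⟨?_, ?_, ?_, ?_, ?_, ?_⟩⟩ <;> linarith

theorem IsAchievable.mem_entropyOuterBound {q₁ : BroadcastChannel X₁ Y₁ Z₁}
    {q₂ : BroadcastChannel X₂ Y₂ Z₂} {R : ℝ × ℝ × ℝ} (h : IsAchievable (q₁.prod q₂) R) :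
    R ∈ BroadcastChannel.entropyOuterBound q₁ q₂ := by
  obtain ⟨h0, h1, h2, c, hY, hZ⟩ := h
  -- Chosen so that n t = 1 + 3 ε with the `ε` below: one bit from rounding the number of messages,
  -- and 7 = 1 + 3 · 2.
  let t : ℕ → ℝ := fun n => 7 / n + (3 * (c n).errY (q₁.prod q₂) * (R.1 + R.2.1)
    + 3 * (c n).errZ (q₁.prod q₂) * (R.1 + R.2.2))
  have ht : Tendsto t atTop (𝓝 0) := by
    have := (tendsto_const_div_atTop_nhds_zero_nat 7).add
      (((hY.const_mul 3).mul_const (R.1 + R.2.1)).add ((hZ.const_mul 3).mul_const (R.1 + R.2.2)))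
    simpa using this
  have hlim : Tendsto (fun n => (R.1 - t n, R.2.1 - t n, R.2.2 - t n)) atTop (𝓝 R) := by
    have h := (ht.const_sub R.1).prodMk_nhds ((ht.const_sub R.2.1).prodMk_nhds (ht.const_sub R.2.2))
    simpa using h
  refine (BroadcastChannel.isClosed_entropyOuterBound q₁ q₂).mem_of_tendsto hlim ?_
  filter_upwards [eventually_gt_atTop 0] with n hn
  obtain ⟨k0, a0, b0⟩ := logb_numMessages_le (n := n) h0
  obtain ⟨k1, a1, b1⟩ := logb_numMessages_le (n := n) h1
  obtain ⟨k2, a2, b2⟩ := logb_numMessages_le (n := n) h2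
  have eY := (c n).errY_nonneg q₁ q₂
  have eZ := (c n).errZ_nonneg q₁ q₂
  have hn' : (0 : ℝ) < n := by exact_mod_cast hn
  -- The sum of both Fano bounds, so that one `ε` serves both receivers.
  set ε : ℝ := 2 + (c n).errY (q₁.prod q₂) * (n * R.1 + n * R.2.1)
    + (c n).errZ (q₁.prod q₂) * (n * R.1 + n * R.2.2) with hε
  have cY : 0 ≤ (c n).errY (q₁.prod q₂) * (n * R.1 + n * R.2.1) :=
    mul_nonneg eY (add_nonneg (mul_nonneg hn'.le h0) (mul_nonneg hn'.le h1))
  have cZ : 0 ≤ (c n).errZ (q₁.prod q₂) * (n * R.1 + n * R.2.2) :=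
    mul_nonneg eZ (add_nonneg (mul_nonneg hn'.le h0) (mul_nonneg hn'.le h2))
  have dY := mul_le_mul_of_nonneg_left (add_le_add a0 a1) eY
  have dZ := mul_le_mul_of_nonneg_left (add_le_add a0 a2) eZ
  obtain ⟨κ₁, hκ₁, κ₂, hκ₂, H⟩ := (c n).exists_isBoundedBy q₁ q₂ hn k0 k1 k2 (ε := ε)
    (by linarith) (by linarith)
  have htn : n * t n = 1 + 3 * ε := by
    simp only [t, hε]
    field_simp
    ring
  have hle : ∀ r L : ℝ, n * r - 1 ≤ L → r - t n ≤ (L - 3 * ε) / n := by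
    intro r L hL
    rw [le_div_iff₀' hn', mul_sub, htn]
    linarith
  exact ⟨κ₁, hκ₁, κ₂, hκ₂, H.mono ⟨hle _ _ b0, hle _ _ b1, hle _ _ b2⟩⟩

end OuterBound

theorem mainTheorem1 {X₁ Y₁ Z₁ X₂ Y₂ Z₂ : Type*}
    [Fintype X₁] [Fintype Y₁] [Fintype Z₁] [Fintype X₂] [Fintype Y₂] [Fintype Z₂]
    (q₁ : BroadcastChannel X₁ Y₁ Z₁) (q₂ : BroadcastChannel X₂ Y₂ Z₂) :
    capacityRegion (BroadcastChannel.prod q₁ q₂) ⊆ productOuterBound q₁ q₂ :=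
  (closure_minimal (fun _ h => IsAchievable.mem_entropyOuterBound h)
    (BroadcastChannel.isClosed_entropyOuterBound q₁ q₂)).trans
    (BroadcastChannel.entropyOuterBound_subset q₁ q₂)
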